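/- Let $\alpha>0$, let $N\in\mathbb N$ and $s\in\mathbb R$ with $N>s>2$, and write $\langle(x,\xi)\rangle=(1+x^2+\xi^2)^{1/2}$. For $f,g\in L^2(\mathbb R)$ let $V_gf(x,\xi)=\int_{\mathbb R} f(t)\overline{g(t-x)}e^{-2\pi i t\xi}\,dt$ be the short-time Fourier transform and $W(f,g)(x,\xi)=\int_{\mathbb R} f(x+\tfrac t2)\overline{g(x-\tfrac t2)}e^{-2\pi it\xi}\,dt$ the Wigner distribution. Let $W(\ell^\infty_{\langle\cdot\rangle^N})$ be the space of functions $F$ on $\mathbb R^2$ with $$\sup_{\lambda\in\Lambda}\Big(\operatorname*{ess\,sup}_{\zeta\in\lambda+Q}|F(\zeta)|\Big)\langle\lambda\rangle^N<\infty,\qquad \Lambda=\alpha\mathbb Z\times\tfrac1{2\alpha}\mathbb Z,\quad Q=[0,\alpha)\times[0,\tfrac1{2\alpha}).$$ Let $M^{\infty,\infty}_{1\otimes\langle\cdot\rangle^s}(\mathbb R^2)$ be the space of all $\sigma\in\mathcal S'(\mathbb R^2)$ with $$\operatorname*{ess\,sup}_{\zeta\in\mathbb R^2}\operatorname*{ess\,sup}_{z\in\mathbb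 R^2}|\langle\sigma,\,e^{2\pi i\zeta\cdot(\,\cdot\,)}\Phi(\cdot-z)\rangle|\,\langle\zeta\rangle^s<\infty,\qquad \Phi(u)=e^{-\pi u\cdot u}.$$ Brackets are conjugate-linear in the second argument. For $b\in L^2(\mathbb R)$, $k\in\mathbb Z$ and $l\in\mathbb N\cup\{0\}$ put $$\psi_{k,l}(t)=\sqrt{\tfrac2\alpha}\;b(t-\alpha k)\,\sin\Big(\frac{(2l+1)\pi}{2\alpha}(t-\alpha k)\Big).$$ **(a)** Let $b$ be a bell function, that is, $b(t)=\sin(\theta(t))\cos(\theta(t-\alpha))$ with $\theta(t)=\int_{-\infty}^t\zeta(u)\,du$, where $\zeta\in C^{N-1}(\mathbb R)$ is real and even, has support in $[-\epsilon,\epsilon]$ for some $\epsilon\in(0,\alpha/2)$, and satisfies $\int_{\mathbb R}\zeta=\frac\pi2$. Then $b\in L^2(\mathbb R)$ and $V_bb\in W(\ell^\infty_{\langle\cdot\rangle^N})$. **(b)** Let $\sigma\in M^{\infty,\infty}_{1\otimes\langle\cdot\rangle^s}(\mathbb R^2)$. The Weyl transform $\sigma^w$, given by $\langle\sigma^wf,g\rangle=\langle\sigma,W(g,f)\rangle$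 for $f,g\in\mathcal S(\mathbb R)$, extends to a bounded operator on $L^2(\mathbb R)$. For every $b\in L^2(\mathbb R)$ with $V_bb\in W(\ell^\infty_{\langle\cdot\rangle^N})$ (in particular for every bell function as in (a)) there is a constant $C_s$ such that $$|\langle\sigma^w\psi_{k',l'},\psi_{k,l}\rangle|\le C_s\bigg(\Big\langle\Big(\alpha(k-k'),\frac{l-l'}{2\alpha}\Big)\Big\rangle^{-s}+\Big\langle\Big(\alpha(k-k'),\frac{l+l'}{2\alpha}\Big)\Big\rangle^{-s}\bigg)$$ for all $k,k'\in\mathbb Z$ and $l,l'\in\mathbb N\cup\{0\}$. -/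

import Mathlib

open MeasureTheory SchwartzMap Real
open scoped ContDiff ENNReal

noncomputable section

namespace LocalSine

/-- The Japanese bracket `⟨(x, ξ)⟩ = (1 + x² + ξ²)^{1/2}` on the plane. -/
def japanese (p : ℝ × ℝ) : ℝ := Real.sqrt (1 + p.1 ^ 2 + p.2 ^ 2)

/-! ### The Gaussian window and its time-frequency shifts as Schwartz functions on the plane -/

/-- The exponent of the Gaussian. -/
def quad (u : ℝ × ℝ) : ℝ := -π * (u.1 ^ 2 + u.2 ^ 2)

theorem hasTemperateGrowth_fst : Function.HasTemperateGrowth (fun u : ℝ × ℝ => u.1) :=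
  (ContinuousLinearMap.fst ℝ ℝ ℝ).hasTemperateGrowth

theorem hasTemperateGrowth_snd : Function.HasTemperateGrowth (fun u : ℝ × ℝ => u.2) :=
  (ContinuousLinearMap.snd ℝ ℝ ℝ).hasTemperateGrowth

theorem hasTemperateGrowth_quad : Function.HasTemperateGrowth quad :=
  (Function.HasTemperateGrowth.const (-π)).mul
    ((hasTemperateGrowth_fst.pow 2).add (hasTemperateGrowth_snd.pow 2))

theorem quad_le (u : ℝ × ℝ) : quad u ≤ -‖u‖ ^ 2 := by
  have h1 : ‖u‖ ^ 2 ≤ u.1 ^ 2 + u.2 ^ 2 := by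
    rw [Prod.norm_def]
    rcases max_choice ‖u.1‖ ‖u.2‖ with h | h <;> rw [h, Real.norm_eq_abs, sq_abs] <;>
      nlinarith [sq_nonneg u.1, sq_nonneg u.2]
  have h2 : (3 : ℝ) < π := Real.pi_gt_three
  have h3 : 0 ≤ ‖u‖ ^ 2 := by positivity
  unfold quad
  nlinarith

theorem norm_iteratedFDeriv_exp (i : ℕ) (y : ℝ) :
    ‖iteratedFDeriv ℝ i Real.exp y‖ ≤ Real.exp y := by
  rw [norm_iteratedFDeriv_eq_norm_iteratedDeriv, iteratedDeriv_eq_iterate,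
    Real.iter_deriv_exp, Real.norm_eq_abs, abs_of_pos (Real.exp_pos y)]

theorem poly_mul_exp_le (M : ℕ) (r : ℝ) (hr : 0 ≤ r) :
    (1 + r) ^ M * Real.exp (-r ^ 2) ≤ M.factorial * Real.exp 2 := by
  have h1 : (1 + r) ^ M ≤ M.factorial * Real.exp (1 + r) := by
    have := Real.pow_div_factorial_le_exp (1 + r) (by linarith) M
    rwa [div_le_iff₀ (by positivity), mul_comm] at this
  calc (1 + r) ^ M * Real.exp (-r ^ 2)
      ≤ M.factorial * Real.exp (1 + r) * Real.exp (-r ^ 2) := by gcongr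
    _ = M.factorial * Real.exp (1 + r + -r ^ 2) := by rw [Real.exp_add (1 + r)]; ring
    _ ≤ M.factorial * Real.exp 2 := by
        gcongr
        nlinarith [sq_nonneg (r - 1 / 2)]

/-- The real-valued Gaussian `e^{-π(x² + ξ²)}` as a Schwartz function on the plane. -/
def gaussianReal2 : 𝓢(ℝ × ℝ, ℝ) where
  toFun u := Real.exp (quad u)
  smooth' := Real.contDiff_exp.comp hasTemperateGrowth_quad.1
  decay' := by
    intro k n
    obtain ⟨m, C, hC, h⟩ := hasTemperateGrowth_quad.norm_iteratedFDeriv_le_uniform n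
    refine ⟨n.factorial * (1 + C) ^ n * ((k + m * n).factorial * Real.exp 2), fun x => ?_⟩
    have hx : 1 ≤ 1 + ‖x‖ := by linarith [norm_nonneg x]
    have hp : (1 : ℝ) ≤ (1 + ‖x‖) ^ m := one_le_pow₀ hx
    have hD1 : 1 ≤ (1 + C) * (1 + ‖x‖) ^ m := by nlinarith
    have key := norm_iteratedFDeriv_comp_le (𝕜 := ℝ) (N := ∞) (n := n)
      (g := Real.exp) (f := quad) Real.contDiff_exp hasTemperateGrowth_quad.1
      (by exact_mod_cast le_top) x (C := Real.exp (quad x)) (D := (1 + C) * (1 + ‖x‖) ^ m)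
      (fun i _ => norm_iteratedFDeriv_exp i _)
      (fun i hi hin => (h i hin x).trans (le_trans (by nlinarith)
        (le_self_pow₀ hD1 (by omega))))
    have e1 : ‖x‖ ^ k ≤ (1 + ‖x‖) ^ k := by gcongr; linarith
    have e2 : Real.exp (quad x) ≤ Real.exp (-‖x‖ ^ 2) := Real.exp_le_exp.2 (quad_le x)
    have e3 := poly_mul_exp_le (k + m * n) ‖x‖ (norm_nonneg x)
    calc ‖x‖ ^ k * ‖iteratedFDeriv ℝ n (fun u => Real.exp (quad u)) x‖
        ≤ (1 + ‖x‖) ^ k * (n.factorial * Real.exp (-‖x‖ ^ 2) *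
            ((1 + C) * (1 + ‖x‖) ^ m) ^ n) := by
          gcongr
          refine key.trans ?_
          gcongr
      _ = n.factorial * (1 + C) ^ n *
            ((1 + ‖x‖) ^ (k + m * n) * Real.exp (-‖x‖ ^ 2)) := by
          rw [mul_pow, ← pow_mul, pow_add]; ring
      _ ≤ _ := by gcongr

/-- The Gaussian `Φ(x, ξ) = e^{-π(x² + ξ²)}` as a complex-valued Schwartz function. -/
def gaussian2 : 𝓢(ℝ × ℝ, ℂ) := gaussianReal2.postcompCLM (𝕜 := ℝ) Complex.ofRealCLM

theorem gaussian2_apply (u : ℝ × ℝ) :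
    gaussian2 u = (Real.exp (-π * (u.1 ^ 2 + u.2 ^ 2)) : ℂ) := rfl

/-- The character `u ↦ e^{-2πi ζ·u}` of the plane. -/
def conjCharacter (ζ u : ℝ × ℝ) : ℂ :=
  Complex.exp (-2 * π * Complex.I * ((ζ.1 * u.1 + ζ.2 * u.2 : ℝ) : ℂ))

theorem hasTemperateGrowth_conjCharacter (ζ : ℝ × ℝ) :
    Function.HasTemperateGrowth (conjCharacter ζ) := by
  have h1 : Function.HasTemperateGrowth
      (fun r : ℝ => Complex.exp (Complex.I * (r : ℂ))) := by
    have hcd : ContDiff ℝ ∞ (fun r : ℝ => Complex.exp (Complex.I * (r : ℂ))) :=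
      (contDiff_const.mul Complex.ofRealCLM.contDiff).cexp
    have hd : deriv (fun r : ℝ => Complex.exp (Complex.I * (r : ℂ))) =
        fun r : ℝ => Complex.I * Complex.exp (Complex.I * (r : ℂ)) := by
      funext r
      have := ((Complex.ofRealCLM.hasDerivAt (x := r)).const_mul Complex.I).cexp
      simpa [mul_comm] using this.deriv
    have hn : ∀ n : ℕ, iteratedDeriv n (fun r : ℝ => Complex.exp (Complex.I * (r : ℂ))) =
        fun r : ℝ => Complex.I ^ n * Complex.exp (Complex.I * (r : ℂ)) := by
      intro n
      induction n with
      | zero => simp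
      | succ n ih =>
        rw [iteratedDeriv_succ, ih]
        funext r
        have hdiff : DifferentiableAt ℝ (fun r : ℝ => Complex.exp (Complex.I * (r : ℂ))) r :=
          (hcd.differentiable (by simp)).differentiableAt
        rw [deriv_const_mul _ hdiff, hd, pow_succ]
        ring
    refine ⟨hcd, fun n => ⟨0, 1, fun x => ?_⟩⟩
    rw [norm_iteratedFDeriv_eq_norm_iteratedDeriv, hn]
    simp [Complex.norm_exp]
  have h2 : Function.HasTemperateGrowth
      (fun u : ℝ × ℝ => -2 * π * (ζ.1 * u.1 + ζ.2 * u.2)) :=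
    (Function.HasTemperateGrowth.const (-2 * π)).mul
      (((Function.HasTemperateGrowth.const ζ.1).mul hasTemperateGrowth_fst).add
        ((Function.HasTemperateGrowth.const ζ.2).mul hasTemperateGrowth_snd))
  have h3 := h1.comp h2
  convert h3 using 1
  funext u
  simp only [conjCharacter, Function.comp]
  congr 1
  push_cast
  ring

/-- The complex conjugate of the time-frequency shift `M_ζ T_z Φ` of the Gaussian, i.e. the
Schwartz function `u ↦ e^{-2πi ζ·u} Φ(u - z)`. -/
def conjShiftedGaussian (z ζ : ℝ × ℝ) : 𝓢(ℝ × ℝ, ℂ) :=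
  SchwartzMap.smulLeftCLM ℂ (conjCharacter ζ) (gaussian2.compSubConstCLM ℂ z)

theorem conjShiftedGaussian_apply (z ζ u : ℝ × ℝ) :
    conjShiftedGaussian z ζ u =
      Complex.exp (-2 * π * Complex.I * ((ζ.1 * u.1 + ζ.2 * u.2 : ℝ) : ℂ)) *
        (Real.exp (-π * ((u.1 - z.1) ^ 2 + (u.2 - z.2) ^ 2)) : ℂ) := by
  rw [conjShiftedGaussian, SchwartzMap.smulLeftCLM_apply_apply
    (hasTemperateGrowth_conjCharacter ζ)]
  rfl

/-! ### Short-time Fourier transforms, symbol class and amalgam space -/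

/-- The short-time Fourier transform of a tempered distribution `σ` on the plane with respect to
the Gaussian: `𝓥_Φ σ(z, ζ) = ⟨σ, M_ζ T_z Φ⟩`, where the bracket is conjugate-linear in the second
slot. -/
def symbolSTFT (σ : 𝓢'(ℝ × ℝ, ℂ)) (z ζ : ℝ × ℝ) : ℂ := σ (conjShiftedGaussian z ζ)

/-- The norm of `M^{∞,∞}_{1⊗⟨·⟩^s}(ℝ²)`:
`ess sup_ζ ess sup_z |𝓥_Φ σ(z, ζ)| ⟨ζ⟩^s` (it may be infinite). -/
def modulationNorm (s : ℝ) (σ : 𝓢'(ℝ × ℝ, ℂ)) : ℝ≥0∞ :=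
  essSup (fun ζ : ℝ × ℝ =>
    essSup (fun z : ℝ × ℝ => ‖symbolSTFT σ z ζ‖ₑ * ENNReal.ofReal (japanese ζ ^ s)) volume) volume

/-- Membership in the modulation space `M^{∞,∞}_{1⊗⟨·⟩^s}(ℝ²)`. -/
def MemModulation (s : ℝ) (σ : 𝓢'(ℝ × ℝ, ℂ)) : Prop := modulationNorm s σ < ⊤

/-- The short-time Fourier transform
`V_g f(x, ξ) = ∫ f(t) conj(g(t - x)) e^{-2πi tξ} dt` of functions on the line. -/
def stft (g f : ℝ → ℂ) (p : ℝ × ℝ) : ℂ :=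
  ∫ t : ℝ, f t * (starRingEnd ℂ) (g (t - p.1)) * Complex.exp (-2 * π * Complex.I * t * p.2)

/-- The points of the lattice `Λ = αℤ × (2α)⁻¹ℤ`. -/
def latticePoint (α : ℝ) (m n : ℤ) : ℝ × ℝ := (α * m, n / (2 * α))

/-- The translate by a lattice point of the fundamental domain `[0, α) × [0, 1/(2α))`. -/
def latticeCell (α : ℝ) (m n : ℤ) : Set (ℝ × ℝ) :=
  Set.Ico (α * m) (α * (m + 1)) ×ˢ Set.Ico ((n : ℝ) / (2 * α)) ((n + 1 : ℝ) / (2 * α))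

/-- The norm of the amalgam space `W(ℓ^∞_{⟨·⟩^N}(Λ))`: the sequence of local essential suprema of
`|F|` over the translates of the fundamental domain is measured in `ℓ^∞_{⟨·⟩^N}(Λ)`. -/
def amalgamNorm (α : ℝ) (N : ℕ) (F : ℝ × ℝ → ℂ) : ℝ≥0∞ :=
  ⨆ (m : ℤ) (n : ℤ), essSup (fun p => ‖F p‖ₑ) (volume.restrict (latticeCell α m n)) *
    ENNReal.ofReal (japanese (latticePoint α m n) ^ N)

/-- Membership in the amalgam space `W(ℓ^∞_{⟨·⟩^N}(Λ))`. -/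
def MemAmalgam (α : ℝ) (N : ℕ) (F : ℝ × ℝ → ℂ) : Prop := amalgamNorm α N F < ⊤

/-! ### Weyl calculus -/

/-- The (cross-)Wigner distribution
`W(f, g)(x, ξ) = ∫ f(x + t/2) conj(g(x - t/2)) e^{-2πi tξ} dt`. -/
def wigner (f g : ℝ → ℂ) (p : ℝ × ℝ) : ℂ :=
  ∫ t : ℝ, f (p.1 + t / 2) * (starRingEnd ℂ) (g (p.1 - t / 2)) *
    Complex.exp (-2 * π * Complex.I * t * p.2)

/-- `T` is the Weyl transform `σ^w` as a bounded operator on `L²(ℝ)`: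
`⟨T f, g⟩ = ⟨σ, W(g, f)⟩` for all Schwartz functions `f, g`. Brackets are conjugate-linear in the
second slot, and `conj W(g, f) = W(f, g)`, so the right-hand side is the value of the linear
functional `σ` at the Schwartz function `W(f, g)`. Since Schwartz functions are dense in `L²(ℝ)`,
there is at most one such `T`. -/
def IsWeylOperator (σ : 𝓢'(ℝ × ℝ, ℂ))
    (T : Lp ℂ 2 (volume : Measure ℝ) →L[ℂ] Lp ℂ 2 (volume : Measure ℝ)) : Prop :=
  ∀ f g : 𝓢(ℝ, ℂ), ∃ w : 𝓢(ℝ × ℝ, ℂ), (∀ p, w p = wigner f g p) ∧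
    inner ℂ (g.toLp 2 volume) (T (f.toLp 2 volume)) = σ w

/-! ### Local sine bases -/

/-- The functions
`ψ_{k,l}(t) = √(2/α) b(t - αk) sin((2l+1)π/(2α) (t - αk))`. -/
def localSine (α : ℝ) (b : ℝ → ℂ) (k : ℤ) (l : ℕ) (t : ℝ) : ℂ :=
  (Real.sqrt (2 / α) : ℂ) * b (t - α * k) *
    (Real.sin ((2 * l + 1) * π / (2 * α) * (t - α * k)) : ℂ)

theorem memLp_localSine (α : ℝ) {b : ℝ → ℂ} (hb : MemLp b 2 volume) (k : ℤ) (l : ℕ) :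
    MemLp (localSine α b k l) 2 volume := by
  have h1 : MemLp (fun t : ℝ => b (t - α * k)) 2 volume :=
    hb.comp_measurePreserving (measurePreserving_sub_right volume (α * k))
  have hm : AEStronglyMeasurable (localSine α b k l) volume := by
    refine (h1.1.const_mul (Real.sqrt (2 / α) : ℂ)).mul ?_
    exact (by fun_prop : Continuous fun t : ℝ =>
      (Real.sin ((2 * l + 1) * π / (2 * α) * (t - α * k)) : ℂ)).aestronglyMeasurable
  refine MemLp.of_le (h1.const_mul (Real.sqrt (2 / α) : ℂ)) hm (Filter.Eventually.of_forall ?_)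
  intro t
  rw [localSine, norm_mul]
  refine mul_le_of_le_one_right (norm_nonneg _) ?_
  rw [Complex.norm_real, Real.norm_eq_abs]
  exact Real.abs_sin_le_one _

/-- `ψ_{k,l}` as an element of `L²(ℝ)`. -/
def localSineLp (α : ℝ) {b : ℝ → ℂ} (hb : MemLp b 2 volume) (k : ℤ) (l : ℕ) :
    Lp ℂ 2 (volume : Measure ℝ) :=
  (memLp_localSine α hb k l).toLp (localSine α b k l)

/-- `b` is a bell function of smoothness `N`: there are `ε ∈ (0, α/2)` and an even real function
`ζ ∈ C^{N-1}(ℝ)` with support in `[-ε, ε]` and `∫ ζ = π/2` such that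
`b(t) = sin(θ(t)) cos(θ(t - α))`, where `θ(t) = ∫_{-∞}^t ζ`. -/
def IsBellFunction (α : ℝ) (N : ℕ) (b : ℝ → ℝ) : Prop :=
  ∃ (ε : ℝ) (ζ : ℝ → ℝ), 0 < ε ∧ ε < α / 2 ∧ ContDiff ℝ (N - 1 : ℕ) ζ ∧
    (∀ t, ζ (-t) = ζ t) ∧ Function.support ζ ⊆ Set.Icc (-ε) ε ∧ (∫ t, ζ t) = π / 2 ∧
    ∀ t, b t = Real.sin (∫ u in Set.Iic t, ζ u) * Real.cos (∫ u in Set.Iic (t - α), ζ u)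

end LocalSine

end

/-! Write π(z) for the time-frequency shift `tfShift z`, φ for `gaussian1` and Φ for `gaussian2`.
The Wigner distribution W(π(z)φ, π(w)φ) is again a shifted Gaussian on the plane: up to a constant
factor it is e^{-2π|u|²} centred at (z+w)/2 and modulated by z-w rotated through a right angle
(`wigner_tfShift_gaussian`). Testing σ against it gives the matrix of σ^w between π(z)φ and π(w)φ,
so the hypothesis on σ says that this matrix is O(⟨z-w⟩^{-s})
(`MemModulation.exists_bound_gabor_matrix`). The hypothesis is formulated with Φ and not with
e^{-2π|u|²} = Φ²; writing one factor Φ as a superposition of characters changes the window.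

The analytic engine is that ⟨·⟩^{-s} is integrable on the plane for s > 2 and stable under
convolution (`exists_integral_weight_mul_weight_le`). It drives the change of window, the decay of
V_φ b and the estimate of the matrix coefficients.

Boundedness: the orthogonality relations for the STFT resolve W(f, h) into an integral of W(π(z)φ,
π(w)φ) with coefficients V_φ f(z) conj(V_φ h(w)). Passing σ through the integral and applying
Schur's test bounds |σ(W(f, h))| by a multiple of ‖f‖‖h‖, and the Riesz representation yields the
operator. Passing σ through the integral (`integral_slice`) reduces to a Bochner integral: by
continuity σ is controlled by finitely many seminorms, so by Hahn–Banach it factors through a Banach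
space of bounded continuous functions.

Almost diagonalization: if V_φ F and V_φ G decay like ⟨·⟩^{-s} around a and b, two convolutions with
the matrix bound give |⟨TF, G⟩| = O(⟨a-b⟩^{-s}). Decay of V_b b passes to V_φ b by an orthogonality
relation, and ψ_{k,l} is a difference of two shifts of b, to (αk, ±(2l+1)/(4α)). The four resulting
terms give the two weights of the estimate. For a bell function, V_b b vanishes for large |x| by
compact support and decays in ξ by N integrations by parts. -/

noncomputable section

open scoped ComplexConjugate FourierTransform LineDeriv

namespace LocalSine

universe u

/-! ### Schwartz functions on a product: tensor products and slices -/

section Schwartz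

variable {X E F V : Type*} [NormedAddCommGroup X] [NormedSpace ℝ X] [NormedAddCommGroup E]
  [NormedSpace ℝ E] [NormedAddCommGroup F] [NormedSpace ℝ F] [NormedAddCommGroup V]
  [NormedSpace ℝ V]

/-- The tensor product `(x, y) ↦ f x * g y` of two Schwartz functions. -/
def tensor (f : 𝓢(E, ℂ)) (g : 𝓢(F, ℂ)) : 𝓢(E × F, ℂ) where
  toFun p := f p.1 * g p.2
  smooth' := ((f.smooth ⊤).comp contDiff_fst).mul ((g.smooth ⊤).comp contDiff_snd)
  decay' := by
    intro k n
    have hf : ∀ i (p : E × F), ‖iteratedFDeriv ℝ i (fun p : E × F => f p.1) p‖ ≤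
        ‖iteratedFDeriv ℝ i f p.1‖ := by
      intro i p
      have h := (ContinuousLinearMap.fst ℝ E F).iteratedFDeriv_comp_right (f.smooth ⊤) p
        (i := i) (by exact_mod_cast le_top)
      have h' : iteratedFDeriv ℝ i (fun p : E × F => f p.1) p = _ := h
      rw [h']
      refine (ContinuousMultilinearMap.norm_compContinuousLinearMap_le _ _).trans ?_
      refine mul_le_of_le_one_right (norm_nonneg _) ?_
      exact Finset.prod_le_one (fun _ _ => norm_nonneg _)
        (fun _ _ => ContinuousLinearMap.norm_fst_le ℝ E F)
    have hg : ∀ i (p : E × F), ‖iteratedFDeriv ℝ i (fun p : E × F => g p.2) p‖ ≤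
        ‖iteratedFDeriv ℝ i g p.2‖ := by
      intro i p
      have h := (ContinuousLinearMap.snd ℝ E F).iteratedFDeriv_comp_right (g.smooth ⊤) p
        (i := i) (by exact_mod_cast le_top)
      have h' : iteratedFDeriv ℝ i (fun p : E × F => g p.2) p = _ := h
      rw [h']
      refine (ContinuousMultilinearMap.norm_compContinuousLinearMap_le _ _).trans ?_
      refine mul_le_of_le_one_right (norm_nonneg _) ?_
      exact Finset.prod_le_one (fun _ _ => norm_nonneg _)
        (fun _ _ => ContinuousLinearMap.norm_snd_le ℝ E F)
    refine ⟨∑ i ∈ Finset.range (n + 1), (n.choose i : ℝ) *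
      (SchwartzMap.seminorm ℝ k i f * SchwartzMap.seminorm ℝ 0 (n - i) g +
        SchwartzMap.seminorm ℝ 0 i f * SchwartzMap.seminorm ℝ k (n - i) g), fun p => ?_⟩
    have h := norm_iteratedFDeriv_mul_le (𝕜 := ℝ) (N := ∞) (n := n)
      ((f.smooth ⊤).comp (contDiff_fst (F := F)))
      ((g.smooth ⊤).comp (contDiff_snd (E := E))) p (by exact_mod_cast le_top)
    refine (mul_le_mul_of_nonneg_left h (by positivity)).trans ?_
    rw [Finset.mul_sum]
    refine Finset.sum_le_sum fun i _ => ?_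
    have hk : ‖p‖ ^ k ≤ ‖p.1‖ ^ k + ‖p.2‖ ^ k := by
      rw [Prod.norm_def]
      rcases max_choice ‖p.1‖ ‖p.2‖ with h | h <;> rw [h] <;>
        linarith [pow_nonneg (norm_nonneg p.1) k, pow_nonneg (norm_nonneg p.2) k]
    calc ‖p‖ ^ k * ((n.choose i : ℝ) * ‖iteratedFDeriv ℝ i (f ∘ Prod.fst) p‖ *
          ‖iteratedFDeriv ℝ (n - i) (g ∘ Prod.snd) p‖)
        ≤ (‖p.1‖ ^ k + ‖p.2‖ ^ k) * ((n.choose i : ℝ) * ‖iteratedFDeriv ℝ i f p.1‖ *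
          ‖iteratedFDeriv ℝ (n - i) g p.2‖) := by
          gcongr
          · exact hf i p
          · exact hg (n - i) p
      _ = (n.choose i : ℝ) * ((‖p.1‖ ^ k * ‖iteratedFDeriv ℝ i f p.1‖) *
            (‖p.2‖ ^ 0 * ‖iteratedFDeriv ℝ (n - i) g p.2‖) +
          (‖p.1‖ ^ 0 * ‖iteratedFDeriv ℝ i f p.1‖) *
            (‖p.2‖ ^ k * ‖iteratedFDeriv ℝ (n - i) g p.2‖)) := by ring
      _ ≤ _ := by
          gcongr <;> exact SchwartzMap.le_seminorm ℝ _ _ _ _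

theorem tensor_apply (f : 𝓢(E, ℂ)) (g : 𝓢(F, ℂ)) (p : E × F) : tensor f g p = f p.1 * g p.2 := rfl

/-- The restriction `u ↦ H (x, u)` of a Schwartz function to a vertical slice. -/
def slice (H : 𝓢(X × E, ℂ)) (x : X) : 𝓢(E, ℂ) :=
  compCLMOfAntilipschitz (K := 1) (g := fun u : E => (x, u)) ℂ
    (by
      have : (fun u : E => (x, u)) = fun u => (x, 0) + ContinuousLinearMap.inr ℝ X E u := by
        ext u <;> simp
      rw [this]
      fun_prop)
    (fun _ _ => by simp [Prod.edist_eq]) H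

theorem slice_apply (H : 𝓢(X × E, ℂ)) (x : X) (u : E) : slice H x u = H (x, u) := rfl

theorem iteratedFDeriv_slice {H : X × E → V} (hH : ContDiff ℝ ∞ H) (x : X) (n : ℕ) (u : E) :
    iteratedFDeriv ℝ n (fun u => H (x, u)) u =
      (iteratedFDeriv ℝ n H (x, u)).compContinuousLinearMap
        fun _ => ContinuousLinearMap.inr ℝ X E := by
  have h1 : (fun u => H (x, u)) =
      (fun p => H ((x, 0) + p)) ∘ ContinuousLinearMap.inr ℝ X E := by
    funext u; simp
  rw [h1, (ContinuousLinearMap.inr ℝ X E).iteratedFDeriv_comp_right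
    (f := fun p => H ((x, 0) + p)) (n := ∞) (hH.comp (contDiff_const.add contDiff_id)) u
    (by exact_mod_cast le_top), iteratedFDeriv_comp_add_left]
  simp

/-- A slice derivative is the full derivative restricted along `inr`, of norm at most one, and both
‖x‖ and ‖u‖ are at most ‖(x, u)‖. The spare power ‖x‖^l makes the seminorms of slices integrable in
x. -/
theorem seminorm_slice_le (H : 𝓢(X × E, ℂ)) (k n : ℕ) (l : ℕ) (x : X) :
    ‖x‖ ^ l * SchwartzMap.seminorm ℝ k n (slice H x) ≤ SchwartzMap.seminorm ℝ (l + k) n H := by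
  rcases (pow_nonneg (norm_nonneg x) l).eq_or_lt with h0 | h0
  · rw [← h0, zero_mul]; exact apply_nonneg _ _
  rw [← le_div_iff₀' h0]
  refine SchwartzMap.seminorm_le_bound ℝ k n _ (by positivity) fun u => ?_
  rw [le_div_iff₀' h0]
  have h1 : iteratedFDeriv ℝ n (slice H x) u = _ := iteratedFDeriv_slice (H.smooth ⊤) x n u
  have h2 : ‖iteratedFDeriv ℝ n (slice H x) u‖ ≤ ‖iteratedFDeriv ℝ n H (x, u)‖ := by
    rw [h1]
    refine (ContinuousMultilinearMap.norm_compContinuousLinearMap_le _ _).trans ?_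
    refine mul_le_of_le_one_right (norm_nonneg _) ?_
    exact Finset.prod_le_one (fun _ _ => norm_nonneg _)
      (fun _ _ => ContinuousLinearMap.norm_inr_le_one ℝ X E)
  have hx : ‖x‖ ≤ ‖(x, u)‖ := le_max_left _ _
  have hu : ‖u‖ ≤ ‖(x, u)‖ := le_max_right _ _
  calc ‖x‖ ^ l * (‖u‖ ^ k * ‖iteratedFDeriv ℝ n (slice H x) u‖)
      ≤ ‖(x, u)‖ ^ l * (‖(x, u)‖ ^ k * ‖iteratedFDeriv ℝ n H (x, u)‖) := by gcongr
    _ = ‖(x, u)‖ ^ (l + k) * ‖iteratedFDeriv ℝ n H (x, u)‖ := by rw [pow_add]; ring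
    _ ≤ _ := SchwartzMap.le_seminorm ℝ _ _ _ _

/-- Mean value inequality in the slicing variable, at the cost of one more derivative: slices depend
on x in a Lipschitz way in every seminorm. -/
theorem seminorm_slice_sub_le (H : 𝓢(X × E, ℂ)) (k n : ℕ) (x y : X) :
    SchwartzMap.seminorm ℝ k n (slice H x - slice H y) ≤
      SchwartzMap.seminorm ℝ k (n + 1) H * ‖x - y‖ := by
  refine SchwartzMap.seminorm_le_bound ℝ k n _ (by positivity) fun u => ?_
  have hd : Differentiable ℝ (iteratedFDeriv ℝ n H) :=
    (H.smooth ⊤).differentiable_iteratedFDeriv (by exact_mod_cast WithTop.coe_lt_top _)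
  have hinl : ∀ z : X, HasFDerivAt (fun z : X => (z, u)) (ContinuousLinearMap.inl ℝ X E) z :=
    fun z => hasFDerivAt_prodMk_left z u
  have key := Convex.norm_image_sub_le_of_norm_hasFDerivWithin_le (𝕜 := ℝ) (s := Set.univ)
    (f := (‖u‖ ^ k) • (iteratedFDeriv ℝ n H ∘ fun z : X => (z, u)))
    (f' := fun z : X => ‖u‖ ^ k • (fderiv ℝ (iteratedFDeriv ℝ n H) (z, u)).comp
      (ContinuousLinearMap.inl ℝ X E)) (C := SchwartzMap.seminorm ℝ k (n + 1) H)
    (fun z _ => (((hd (z, u)).hasFDerivAt.comp z (hinl z)).const_smul _).hasFDerivWithinAt)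
    (fun z _ => by
      rw [norm_smul, norm_pow, norm_norm]
      have h1 : ‖(fderiv ℝ (iteratedFDeriv ℝ n H) (z, u)).comp (ContinuousLinearMap.inl ℝ X E)‖ ≤
          ‖iteratedFDeriv ℝ (n + 1) H (z, u)‖ := by
        rw [← norm_fderiv_iteratedFDeriv]
        exact (ContinuousLinearMap.opNorm_comp_le _ _).trans (mul_le_of_le_one_right
          (norm_nonneg _) (ContinuousLinearMap.norm_inl_le_one ℝ X E))
      have hu : ‖u‖ ≤ ‖(z, u)‖ := le_max_right _ _
      calc _ ≤ ‖(z, u)‖ ^ k * ‖iteratedFDeriv ℝ (n + 1) H (z, u)‖ := by gcongr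
        _ ≤ _ := SchwartzMap.le_seminorm ℝ _ _ _ _)
    convex_univ (Set.mem_univ y) (Set.mem_univ x)
  refine le_trans ?_ key
  simp only [Pi.smul_apply, Function.comp]
  rw [← smul_sub, norm_smul, norm_pow, norm_norm]
  gcongr
  have h1 : ∀ z, iteratedFDeriv ℝ n (slice H z) u = _ :=
    fun z => iteratedFDeriv_slice (H.smooth ⊤) z n u
  have h2 : iteratedFDeriv ℝ n (slice H x - slice H y : 𝓢(E, ℂ)) u =
      iteratedFDeriv ℝ n (slice H x) u - iteratedFDeriv ℝ n (slice H y) u :=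
    iteratedFDeriv_sub_apply ((slice H x).contDiffAt n) ((slice H y).contDiffAt n)
  rw [h2, h1, h1]
  set A := iteratedFDeriv ℝ n H (x, u)
  set B := iteratedFDeriv ℝ n H (y, u)
  have h3 : A.compContinuousLinearMap (fun _ => ContinuousLinearMap.inr ℝ X E) -
      B.compContinuousLinearMap (fun _ => ContinuousLinearMap.inr ℝ X E) =
      (A - B).compContinuousLinearMap (fun _ => ContinuousLinearMap.inr ℝ X E) := rfl
  rw [h3]
  refine (ContinuousMultilinearMap.norm_compContinuousLinearMap_le _ _).trans ?_
  refine mul_le_of_le_one_right (norm_nonneg _) ?_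
  exact Finset.prod_le_one (fun _ _ => norm_nonneg _)
    (fun _ _ => ContinuousLinearMap.norm_inr_le_one ℝ X E)

theorem continuous_slice (H : 𝓢(X × E, ℂ)) : Continuous (slice H) := by
  refine continuous_iff_continuousAt.2 fun x => ?_
  refine ((schwartz_withSeminorms ℝ E ℂ).tendsto_nhds _ _).2 ?_
  rintro ⟨k, n⟩ ε hε
  have hc : Filter.Tendsto (fun y => SchwartzMap.seminorm ℝ k (n + 1) H * ‖y - x‖) (nhds x)
      (nhds 0) := by
    have : Continuous fun y => SchwartzMap.seminorm ℝ k (n + 1) H * ‖y - x‖ := by fun_prop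
    simpa using this.tendsto x
  filter_upwards [hc.eventually (gt_mem_nhds hε)] with y hy
  exact (seminorm_slice_sub_le H k n y x).trans_lt hy

/-! ### Integrating slices, and passing a tempered distribution through the integral -/

section Integral

variable [MeasurableSpace X] [BorelSpace X] [SecondCountableTopology X] {μ : Measure X}
  [μ.HasTemperateGrowth]

-- The bound is uniform in u, as domination under the integral sign requires.
omit [BorelSpace X] [SecondCountableTopology X] in
theorem exists_integrable_bound_slice (H : 𝓢(X × E, V)) :
    ∃ bound : X → ℝ, Integrable bound μ ∧ ∀ x u, ‖H (x, u)‖ ≤ bound x := by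
  set l := μ.integrablePower
  refine ⟨fun x => 2 ^ l * (SchwartzMap.seminorm ℝ 0 0 H + SchwartzMap.seminorm ℝ l 0 H) *
    (1 + ‖x‖) ^ (-(l : ℝ)), (μ.integrable_pow_neg_integrablePower).const_mul _, fun x u => ?_⟩
  have h := pow_mul_le_of_le_of_pow_mul_le (k := 0) (l := l) (norm_nonneg x)
    (norm_nonneg (H (x, u))) (SchwartzMap.norm_le_seminorm ℝ H (x, u))
    (C₂ := SchwartzMap.seminorm ℝ l 0 H) (by
      have hx : ‖x‖ ≤ ‖(x, u)‖ := le_max_left _ _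
      calc ‖x‖ ^ (0 + l) * ‖H (x, u)‖ ≤ ‖(x, u)‖ ^ l * ‖H (x, u)‖ := by rw [zero_add]; gcongr
        _ ≤ _ := SchwartzMap.norm_pow_mul_le_seminorm ℝ H l (x, u))
  simpa using h

/-- Differentiation under the integral sign for the slices of a Schwartz function. -/
theorem iteratedFDeriv_integral_slice {E : Type u} [NormedAddCommGroup E] [NormedSpace ℝ E]
    (n : ℕ) : ∀ {V : Type u} [NormedAddCommGroup V] [NormedSpace ℝ V] (H : 𝓢(X × E, V)) (u : E),
    iteratedFDeriv ℝ n (fun u => ∫ x, H (x, u) ∂μ) u =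
      ∫ x, iteratedFDeriv ℝ n (fun u => H (x, u)) u ∂μ := by
  -- The target space varies in the induction, since one derivative replaces V by E →L[ℝ] V; E and V
  -- share a universe so that this space stays in it.
  induction n with
  | zero =>
    intro V _ _ H u
    have h : ∀ f : E → V, iteratedFDeriv ℝ 0 f u =
        (continuousMultilinearCurryFin0 ℝ E V).symm (f u) := fun f => by
      rw [iteratedFDeriv_zero_eq_comp]; rfl
    simp only [h]
    exact ((continuousMultilinearCurryFin0 ℝ E V).symm.toContinuousLinearEquiv.integral_comp_comm
      _).symm
  | succ n ih =>
    intro V _ _ H u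
    -- The partial derivative of H in the second variable, again Schwartz, to which the induction
    -- hypothesis applies.
    set H' : 𝓢(X × E, E →L[ℝ] V) := postcompCLM (𝕜 := ℝ)
      ((ContinuousLinearMap.compL ℝ E (X × E) V).flip (ContinuousLinearMap.inr ℝ X E))
      (fderivCLM ℝ (X × E) V H) with hH'
    have hd : ∀ x u, HasFDerivAt (fun u => H (x, u)) (H' (x, u)) u := fun x u =>
      (H.hasFDerivAt (x, u)).comp u (hasFDerivAt_prodMk_right x u)
    obtain ⟨b₀, hb₀, h₀⟩ := exists_integrable_bound_slice (μ := μ) H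
    obtain ⟨b₁, hb₁, h₁⟩ := exists_integrable_bound_slice (μ := μ) H'
    have hm : ∀ u, AEStronglyMeasurable (fun x => H (x, u)) μ := fun u =>
      (H.continuous.comp (by fun_prop : Continuous fun x : X => (x, u))).aestronglyMeasurable
    have hm' : ∀ u, AEStronglyMeasurable (fun x => H' (x, u)) μ := fun u =>
      (H'.continuous.comp (by fun_prop : Continuous fun x : X => (x, u))).aestronglyMeasurable
    have hfd : fderiv ℝ (fun u => ∫ x, H (x, u) ∂μ) = fun u => ∫ x, H' (x, u) ∂μ := by
      funext u
      exact (hasFDerivAt_integral_of_dominated_of_fderiv_le (s := Set.univ) Filter.univ_mem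
        (Filter.Eventually.of_forall hm)
        (hb₀.mono' (hm u) (Filter.Eventually.of_forall fun x => h₀ x u)) (hm' u)
        (Filter.Eventually.of_forall fun x v _ => h₁ x v) hb₁
        (Filter.Eventually.of_forall fun x v _ => hd x v)).fderiv
    have hfd' : ∀ x, fderiv ℝ (fun u => H (x, u)) = fun u => H' (x, u) := fun x => by
      funext u; exact (hd x u).fderiv
    simp only [iteratedFDeriv_succ_eq_comp_right, Function.comp, hfd, hfd', ih H' u]
    let e : (E [×n]→L[ℝ] (E →L[ℝ] V)) ≃L[ℝ] (E [×n + 1]→L[ℝ] V) :=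
      (continuousMultilinearCurryRightEquiv' ℝ n E V).symm.toContinuousLinearEquiv
    exact (ContinuousLinearEquiv.integral_comp_comm (𝕜 := ℝ) (μ := μ)
      (E := E [×n]→L[ℝ] (E →L[ℝ] V)) (F := E [×n + 1]→L[ℝ] V) e
      fun x => iteratedFDeriv ℝ n (fun u => H' (x, u)) u).symm

/-- The space of continuous multilinear forms on `E` as a normed space. -/
def MultilinearForm (E : Type) [NormedAddCommGroup E] [NormedSpace ℝ E] (n : ℕ) : Type :=
  E [×n]→L[ℝ] ℂ

section

variable {E : Type} [NormedAddCommGroup E] [NormedSpace ℝ E]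

instance (n : ℕ) : NormedAddCommGroup (MultilinearForm E n) :=
  inferInstanceAs (NormedAddCommGroup (E [×n]→L[ℝ] ℂ))

instance (n : ℕ) : NormedSpace ℝ (MultilinearForm E n) :=
  inferInstanceAs (NormedSpace ℝ (E [×n]→L[ℝ] ℂ))

instance (n : ℕ) : NormedSpace ℂ (MultilinearForm E n) :=
  inferInstanceAs (NormedSpace ℂ (E [×n]→L[ℝ] ℂ))

instance (n : ℕ) : CompleteSpace (MultilinearForm E n) :=
  inferInstanceAs (CompleteSpace (E [×n]→L[ℝ] ℂ))

/-- The weighted derivative `u ↦ ‖u‖ ^ k • D ^ n f u` as a function into the multilinear forms. -/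
def weightedDerivFun (k n : ℕ) (f : 𝓢(E, ℂ)) (u : E) : MultilinearForm E n :=
  (‖u‖ ^ k) • iteratedFDeriv ℝ n f u

theorem norm_weightedDerivFun (k n : ℕ) (f : 𝓢(E, ℂ)) (u : E) :
    ‖weightedDerivFun k n f u‖ = ‖u‖ ^ k * ‖iteratedFDeriv ℝ n f u‖ := by
  change ‖(‖u‖ ^ k) • iteratedFDeriv ℝ n f u‖ = _
  rw [norm_smul, norm_pow, norm_norm]

theorem continuous_weightedDerivFun (k n : ℕ) (f : 𝓢(E, ℂ)) :
    Continuous (weightedDerivFun k n f) :=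
  (continuous_norm.pow k).smul
    ((f.smooth ⊤).continuous_iteratedFDeriv (m := n) (by exact_mod_cast le_top))

theorem weightedDerivFun_add (k n : ℕ) (f g : 𝓢(E, ℂ)) (u : E) :
    weightedDerivFun k n (f + g) u = weightedDerivFun k n f u + weightedDerivFun k n g u := by
  have : iteratedFDeriv ℝ n (f + g : 𝓢(E, ℂ)) u = _ :=
    iteratedFDeriv_add_apply (f.contDiffAt n) (g.contDiffAt n)
  unfold weightedDerivFun
  rw [this]
  exact smul_add _ _ _

theorem weightedDerivFun_smul (k n : ℕ) (c : ℂ) (f : 𝓢(E, ℂ)) (u : E) :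
    weightedDerivFun k n (c • f) u = c • weightedDerivFun k n f u := by
  have : iteratedFDeriv ℝ n (c • f : 𝓢(E, ℂ)) u = _ :=
    iteratedFDeriv_const_smul_apply (f.contDiffAt n)
  unfold weightedDerivFun
  rw [this]
  exact smul_comm (‖u‖ ^ k) c (iteratedFDeriv ℝ n f u)

/-- The map `f ↦ ‖u‖ ^ k • D ^ n f u` from Schwartz functions to bounded continuous functions. -/
def weightedDeriv (k n : ℕ) :
    𝓢(E, ℂ) →ₗ[ℂ] BoundedContinuousFunction E (MultilinearForm E n) where
  toFun f := BoundedContinuousFunction.ofNormedAddCommGroup (weightedDerivFun k n f)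
    (continuous_weightedDerivFun k n f) (SchwartzMap.seminorm ℝ k n f) (fun u => by
      rw [norm_weightedDerivFun]; exact SchwartzMap.le_seminorm ℝ k n f u)
  map_add' f g := by ext1 u; exact weightedDerivFun_add k n f g u
  map_smul' c f := by ext1 u; exact weightedDerivFun_smul k n c f u

theorem weightedDeriv_apply (k n : ℕ) (f : 𝓢(E, ℂ)) (u : E) :
    weightedDeriv k n f u = weightedDerivFun k n f u := rfl

theorem norm_weightedDeriv_le (k n : ℕ) (f : 𝓢(E, ℂ)) :
    ‖weightedDeriv k n f‖ ≤ SchwartzMap.seminorm ℝ k n f :=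
  BoundedContinuousFunction.norm_ofNormedAddCommGroup_le _ (apply_nonneg _ _) fun u => by
    rw [norm_weightedDerivFun]; exact SchwartzMap.le_seminorm ℝ k n f u

theorem seminorm_le_norm_weightedDeriv (k n : ℕ) (f : 𝓢(E, ℂ)) :
    SchwartzMap.seminorm ℂ k n f ≤ ‖weightedDeriv k n f‖ := by
  refine SchwartzMap.seminorm_le_bound ℂ k n f (norm_nonneg _) fun u => ?_
  have := (weightedDeriv k n f).norm_coe_le_norm u
  rwa [weightedDeriv_apply, norm_weightedDerivFun] at this

omit [MeasurableSpace X] [BorelSpace X] [SecondCountableTopology X] in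
theorem continuous_weightedDeriv_slice (H : 𝓢(X × E, ℂ)) (k n : ℕ) :
    Continuous fun x => weightedDeriv k n (slice H x) := by
  refine continuous_iff_continuousAt.2 fun x => ?_
  refine tendsto_iff_norm_sub_tendsto_zero.2 ?_
  have hc : Filter.Tendsto (fun y => SchwartzMap.seminorm ℝ k (n + 1) H * ‖y - x‖) (nhds x)
      (nhds 0) := by
    have : Continuous fun y => SchwartzMap.seminorm ℝ k (n + 1) H * ‖y - x‖ := by fun_prop
    simpa using this.tendsto x
  refine squeeze_zero (fun _ => norm_nonneg _) (fun y => ?_) hc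
  rw [← map_sub]
  exact (norm_weightedDeriv_le k n _).trans (seminorm_slice_sub_le H k n y x)

theorem integrable_weightedDeriv_slice (H : 𝓢(X × E, ℂ)) (k n : ℕ) :
    Integrable (fun x => weightedDeriv k n (slice H x)) μ := by
  set l := μ.integrablePower
  refine ((μ.integrable_pow_neg_integrablePower).const_mul (2 ^ l *
    (SchwartzMap.seminorm ℝ (0 + k) n H + SchwartzMap.seminorm ℝ (l + k) n H))).mono'
    (continuous_weightedDeriv_slice H k n).aestronglyMeasurable
    (Filter.Eventually.of_forall fun x => ?_)
  refine (norm_weightedDeriv_le k n _).trans ?_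
  have h := pow_mul_le_of_le_of_pow_mul_le (k := 0) (l := l) (norm_nonneg x)
    (apply_nonneg (SchwartzMap.seminorm ℝ k n) (slice H x))
    (by simpa using seminorm_slice_le H k n 0 x)
    (by simpa using seminorm_slice_le H k n l x)
  simpa using h

/-- Evaluation at u is continuous and linear, so the Bochner integral in the space of bounded
continuous functions can be computed pointwise, where it is differentiation under the integral sign.
-/
theorem integral_weightedDeriv_slice (H : 𝓢(X × E, ℂ)) (G : 𝓢(E, ℂ))
    (hG : ∀ u, G u = ∫ x, H (x, u) ∂μ) (k n : ℕ) :
    ∫ x, weightedDeriv k n (slice H x) ∂μ = weightedDeriv k n G := by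
  ext1 u
  have h1 := (BoundedContinuousFunction.evalCLM ℝ u).integral_comp_comm
    (integrable_weightedDeriv_slice (μ := μ) H k n)
  have h2 : (G : E → ℂ) = fun u => ∫ x, H (x, u) ∂μ := funext hG
  change (BoundedContinuousFunction.evalCLM ℝ u) (∫ x, weightedDeriv k n (slice H x) ∂μ) = _
  have h3 : weightedDerivFun k n G u =
      ∫ x, (‖u‖ ^ k) • iteratedFDeriv ℝ n (fun u => H (x, u)) u ∂μ := by
    rw [integral_smul, ← iteratedFDeriv_integral_slice n H u, ← h2]
    rfl
  rw [← h1, weightedDeriv_apply, h3]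
  rfl

/-- A tempered distribution commutes with the integral of the slices of a Schwartz function. -/
theorem integral_slice (σ : 𝓢(E, ℂ) →L[ℂ] ℂ) (H : 𝓢(X × E, ℂ)) (G : 𝓢(E, ℂ))
    (hG : ∀ u, G u = ∫ x, H (x, u) ∂μ) : ∫ x, σ (slice H x) ∂μ = σ G := by
  -- Continuity bounds σ by finitely many Schwartz seminorms. The map e below records exactly these
  -- weighted derivatives, so that |σ f| ≤ C ‖e f‖ with values of e in a Banach space.
  obtain ⟨S, C, -, hC⟩ := Seminorm.bound_of_continuous (schwartz_withSeminorms ℂ E ℂ)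
    ((normSeminorm ℂ ℂ).comp σ.toLinearMap) (by exact σ.continuous.norm)
  let e : 𝓢(E, ℂ) →ₗ[ℂ] (∀ i : S, BoundedContinuousFunction E (MultilinearForm E i.1.2)) :=
    LinearMap.pi fun i => weightedDeriv i.1.1 i.1.2
  have hb : ∃ C : ℝ, ∀ f, ‖σ.toLinearMap f‖ ≤ C * ‖e f‖ := by
    refine ⟨C, fun f => (hC f).trans ?_⟩
    rw [smul_apply, NNReal.smul_def, smul_eq_mul]
    refine mul_le_mul_of_nonneg_left ?_ C.2
    refine Seminorm.finset_sup_apply_le (norm_nonneg _) fun i hi => ?_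
    exact (seminorm_le_norm_weightedDeriv i.1 i.2 f).trans (norm_le_pi_norm (e f) ⟨i, hi⟩)
  -- By this bound σ descends to the range of e; Hahn–Banach extends it to a continuous functional L
  -- with L ∘ e = σ, which commutes with Bochner integrals.
  obtain ⟨L, hL, -⟩ := exists_extension_norm_eq _ (σ.toLinearMap.compLeftInverse e)
  have hLe : ∀ f, L (e f) = σ f := fun f => by
    rw [hL ⟨e f, LinearMap.mem_range_self e f⟩]
    exact LinearMap.compLeftInverse_apply_of_bdd _ _ hb f _ rfl
  have hint : Integrable (fun x => e (slice H x)) μ :=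
    Integrable.of_eval fun i => integrable_weightedDeriv_slice H _ _
  have heG : ∫ x, e (slice H x) ∂μ = e G := by
    funext i
    exact (eval_integral (f := fun x i => e (slice H x) i)
      (fun i => integrable_weightedDeriv_slice H i.1.1 i.1.2) i).trans
      (integral_weightedDeriv_slice H G hG _ _)
  simp only [← hLe]
  rw [L.integral_comp_comm hint, heG]

end

end Integral
end Schwartz

/-! ### The partial Fourier transform preserves Schwartz functions -/

/-- The kernel `e^{-2πi tξ}` of the Fourier transform. -/
def fourierKernel (t ξ : ℝ) : ℂ := Complex.exp (-2 * π * Complex.I * t * ξ)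

theorem norm_fourierKernel (t ξ : ℝ) : ‖fourierKernel t ξ‖ = 1 := by
  have : -2 * π * Complex.I * t * ξ = ((-2 * π * t * ξ : ℝ) : ℂ) * Complex.I := by
    push_cast; ring
  rw [fourierKernel, this, Complex.norm_exp_ofReal_mul_I]

theorem continuous_fourierKernel : Continuous fun p : ℝ × ℝ => fourierKernel p.1 p.2 := by
  unfold fourierKernel; fun_prop

theorem fourier_eq_integral_kernel (f : ℝ → ℂ) (ξ : ℝ) :
    FourierTransform.fourier f ξ = ∫ t, f t * fourierKernel t ξ := by
  rw [Real.fourier_real_eq_integral_exp_smul]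
  refine integral_congr_ae (Filter.Eventually.of_forall fun t => ?_)
  simp only [smul_eq_mul, fourierKernel]
  rw [mul_comm]
  congr 2
  push_cast; ring

/-- The partial Fourier transform `(x, ξ) ↦ ∫ H (t, x) e^{-2πi tξ} dt`. -/
def partialFourierFun (H : 𝓢(ℝ × ℝ, ℂ)) (p : ℝ × ℝ) : ℂ :=
  ∫ t : ℝ, H (t, p.1) * fourierKernel t p.2

theorem hasTemperateGrowth_mulFst (c : ℂ) :
    Function.HasTemperateGrowth (fun q : ℝ × ℝ => c * (q.1 : ℂ)) :=
  (Function.HasTemperateGrowth.const c).mul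
    (Complex.ofRealCLM.hasTemperateGrowth.comp hasTemperateGrowth_fst)

theorem hasTemperateGrowth_sndPow (k : ℕ) :
    Function.HasTemperateGrowth (fun q : ℝ × ℝ => (q.2 : ℂ) ^ k) :=
  (Complex.ofRealCLM.hasTemperateGrowth.comp hasTemperateGrowth_snd).pow k

/-- The x-derivative falls on H and the ξ-derivative brings down -2πit. Both partial derivatives are
thus partial Fourier transforms of Schwartz functions, which makes induction on the order possible.
-/
theorem hasFDerivAt_partialFourierFun (H : 𝓢(ℝ × ℝ, ℂ)) (p : ℝ × ℝ) :
    HasFDerivAt (partialFourierFun H)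
      ((ContinuousLinearMap.fst ℝ ℝ ℝ).smulRight
          (partialFourierFun (∂_{((0, 1) : ℝ × ℝ)} H) p) +
        (ContinuousLinearMap.snd ℝ ℝ ℝ).smulRight
          (partialFourierFun (smulLeftCLM ℂ
            (fun q : ℝ × ℝ => (-2 * π * Complex.I) * (q.1 : ℂ)) H) p)) p := by
  set H₁ := ∂_{((0, 1) : ℝ × ℝ)} H with hH₁
  set H₂ := smulLeftCLM ℂ (fun q : ℝ × ℝ => (-2 * π * Complex.I) * (q.1 : ℂ)) H with hH₂
  have hH₂a : ∀ q, H₂ q = (-2 * π * Complex.I) * (q.1 : ℂ) * H q := fun q => by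
    rw [hH₂, smulLeftCLM_apply_apply (hasTemperateGrowth_mulFst _), smul_eq_mul]
  have hm : ∀ (K : 𝓢(ℝ × ℝ, ℂ)) (p : ℝ × ℝ),
      Continuous (fun t : ℝ => K (t, p.1) * fourierKernel t p.2) := fun K p =>
    (K.continuous.comp (by fun_prop : Continuous fun t : ℝ => (t, p.1))).mul
      (continuous_fourierKernel.comp (by fun_prop : Continuous fun t : ℝ => (t, p.2)))
  obtain ⟨b₀, hb₀, h₀⟩ := exists_integrable_bound_slice (μ := volume) H
  obtain ⟨b₁, hb₁, h₁⟩ := exists_integrable_bound_slice (μ := volume) H₁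
  obtain ⟨b₂, hb₂, h₂⟩ := exists_integrable_bound_slice (μ := volume) H₂
  have hint : ∀ (K : 𝓢(ℝ × ℝ, ℂ)) (b : ℝ → ℝ), Integrable b → (∀ x u, ‖K (x, u)‖ ≤ b x) →
      ∀ p : ℝ × ℝ, Integrable (fun t : ℝ => K (t, p.1) * fourierKernel t p.2) :=
    fun K b hb h p => hb.mono' (hm K p).aestronglyMeasurable
      (Filter.Eventually.of_forall fun t => by
        rw [norm_mul, norm_fourierKernel, mul_one]; exact h t _)
  have hker : ∀ (t ξ : ℝ), HasDerivAt (fun ξ : ℝ => fourierKernel t ξ)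
      ((-2 * π * Complex.I * t) * fourierKernel t ξ) ξ := fun t ξ => by
    have := ((Complex.ofRealCLM.hasDerivAt (x := ξ)).const_mul (-2 * π * Complex.I * t)).cexp
    simpa [fourierKernel, mul_comm] using this
  set F' : ℝ × ℝ → ℝ → (ℝ × ℝ →L[ℝ] ℂ) := fun p t =>
    (ContinuousLinearMap.fst ℝ ℝ ℝ).smulRight (H₁ (t, p.1) * fourierKernel t p.2) +
      (ContinuousLinearMap.snd ℝ ℝ ℝ).smulRight (H₂ (t, p.1) * fourierKernel t p.2) with hF'
  have hd : ∀ (t : ℝ) (p : ℝ × ℝ),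
      HasFDerivAt (fun p : ℝ × ℝ => H (t, p.1) * fourierKernel t p.2) (F' p t) p := by
    intro t p
    have e1 : HasFDerivAt (fun p : ℝ × ℝ => H (t, p.1))
        ((fderiv ℝ H (t, p.1)).comp ((ContinuousLinearMap.inr ℝ ℝ ℝ).comp
          (ContinuousLinearMap.fst ℝ ℝ ℝ))) p :=
      (H.hasFDerivAt (t, p.1)).comp p
        ((hasFDerivAt_prodMk_right t p.1).comp p hasFDerivAt_fst)
    have e2 : HasFDerivAt (fun p : ℝ × ℝ => fourierKernel t p.2) _ p :=
      (hker t p.2).hasFDerivAt.comp p hasFDerivAt_snd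
    refine (e1.mul e2).congr_fderiv ?_
    have e3 : H₁ (t, p.1) = fderiv ℝ H (t, p.1) (0, 1) := rfl
    have e4 : ∀ r : ℝ, fderiv ℝ H (t, p.1) (0, r) = r • fderiv ℝ H (t, p.1) (0, 1) := fun r => by
      rw [← map_smul]; simp
    have e5 : fderiv ℝ H (t, p.1) (0, 0) = 0 := map_zero _
    ext
    · simp [hF', e3, mul_comm]
    · simp [hF', e3, e5, hH₂a]; ring
  have hsr : ∀ (L : ℝ × ℝ →L[ℝ] ℝ), ‖L‖ ≤ 1 → ∀ c : ℂ, ‖L.smulRight c‖ ≤ ‖c‖ := fun L hL c => by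
    rw [ContinuousLinearMap.norm_smulRight_apply]
    exact mul_le_of_le_one_left (norm_nonneg _) hL
  have hF'c : Continuous (F' p) := by
    have : F' p = fun t =>
      ContinuousLinearMap.smulRightL ℝ (ℝ × ℝ) ℂ (ContinuousLinearMap.fst ℝ ℝ ℝ)
        (H₁ (t, p.1) * fourierKernel t p.2) +
      ContinuousLinearMap.smulRightL ℝ (ℝ × ℝ) ℂ (ContinuousLinearMap.snd ℝ ℝ ℝ)
        (H₂ (t, p.1) * fourierKernel t p.2) := rfl
    rw [this]
    have a1 := hm H₁ p
    have a2 := hm H₂ p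
    fun_prop
  have key := hasFDerivAt_integral_of_dominated_of_fderiv_le (μ := volume)
    (F := fun p t => H (t, p.1) * fourierKernel t p.2) (F' := F') (x₀ := p) (s := Set.univ)
    (bound := fun t => b₁ t + b₂ t) Filter.univ_mem
    (Filter.Eventually.of_forall fun p => (hm H p).aestronglyMeasurable)
    (hint H b₀ hb₀ h₀ p) hF'c.aestronglyMeasurable
    (Filter.Eventually.of_forall fun t q _ => by
      refine (norm_add_le _ _).trans (add_le_add ?_ ?_)
      · refine (hsr _ (ContinuousLinearMap.norm_fst_le ℝ ℝ ℝ) _).trans ?_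
        rw [norm_mul, norm_fourierKernel, mul_one]; exact h₁ t _
      · refine (hsr _ (ContinuousLinearMap.norm_snd_le ℝ ℝ ℝ) _).trans ?_
        rw [norm_mul, norm_fourierKernel, mul_one]; exact h₂ t _)
    (hb₁.add hb₂) (Filter.Eventually.of_forall fun t q _ => hd t q)
  refine key.congr_fderiv ?_
  have i1 := hint H₁ b₁ hb₁ h₁ p
  have i2 := hint H₂ b₂ hb₂ h₂ p
  have c1 := (ContinuousLinearMap.smulRightL ℝ (ℝ × ℝ) ℂ
    (ContinuousLinearMap.fst ℝ ℝ ℝ)).integral_comp_comm i1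
  have c2 := (ContinuousLinearMap.smulRightL ℝ (ℝ × ℝ) ℂ
    (ContinuousLinearMap.snd ℝ ℝ ℝ)).integral_comp_comm i2
  have j1 := (ContinuousLinearMap.smulRightL ℝ (ℝ × ℝ) ℂ
    (ContinuousLinearMap.fst ℝ ℝ ℝ)).integrable_comp i1
  have j2 := (ContinuousLinearMap.smulRightL ℝ (ℝ × ℝ) ℂ
    (ContinuousLinearMap.snd ℝ ℝ ℝ)).integrable_comp i2
  exact (integral_add j1 j2).trans (congrArg₂ (· + ·) c1 c2)

theorem exists_bound_partialFourierFun (H : 𝓢(ℝ × ℝ, ℂ)) :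
    ∃ C, ∀ p, ‖partialFourierFun H p‖ ≤ C := by
  obtain ⟨b₀, hb₀, h₀⟩ := exists_integrable_bound_slice (μ := volume) H
  refine ⟨∫ t, b₀ t, fun p => ?_⟩
  refine norm_integral_le_of_norm_le hb₀ (Filter.Eventually.of_forall fun t => ?_)
  rw [norm_mul, norm_fourierKernel, mul_one]
  exact h₀ t _

/-- Integration by parts in t, the source of decay in ξ. -/
theorem partialFourierFun_lineDeriv (H : 𝓢(ℝ × ℝ, ℂ)) (p : ℝ × ℝ) :
    partialFourierFun (∂_{((1, 0) : ℝ × ℝ)} H) p =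
      (2 * π * Complex.I * p.2) * partialFourierFun H p := by
  set f : ℝ → ℂ := fun t => H (t, p.1)
  have hd : ∀ t, HasDerivAt f (∂_{((1, 0) : ℝ × ℝ)} H (t, p.1)) t := fun t => by
    have := (H.hasFDerivAt (t, p.1)).comp_hasDerivAt t
      ((hasDerivAt_id t).prodMk (hasDerivAt_const t p.1))
    exact this
  obtain ⟨b₀, hb₀, h₀⟩ := exists_integrable_bound_slice (μ := volume) H
  obtain ⟨b₁, hb₁, h₁⟩ := exists_integrable_bound_slice (μ := volume) (∂_{((1, 0) : ℝ × ℝ)} H)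
  have hdf : deriv f = fun t => ∂_{((1, 0) : ℝ × ℝ)} H (t, p.1) := funext fun t => (hd t).deriv
  have hc : Continuous fun t : ℝ => ∂_{((1, 0) : ℝ × ℝ)} H (t, p.1) :=
    (∂_{((1, 0) : ℝ × ℝ)} H).continuous.comp (by fun_prop : Continuous fun t : ℝ => (t, p.1))
  have hcf : Continuous f := H.continuous.comp (by fun_prop : Continuous fun t : ℝ => (t, p.1))
  have key := Real.fourier_deriv (f := f)
    (hb₀.mono' hcf.aestronglyMeasurable (Filter.Eventually.of_forall fun t => h₀ t _))
    (fun t => (hd t).differentiableAt)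
    (by rw [hdf]; exact hb₁.mono' hc.aestronglyMeasurable
          (Filter.Eventually.of_forall fun t => h₁ t _))
  have key' := congrFun key p.2
  rw [hdf, fourier_eq_integral_kernel, fourier_eq_integral_kernel, smul_eq_mul] at key'
  exact key'

/-- Powers of x are absorbed into H before transforming; each power of ξ is paid for by a
t-derivative of H. -/
theorem exists_pow_mul_bound_partialFourierFun (k : ℕ) (H : 𝓢(ℝ × ℝ, ℂ)) :
    ∃ C, ∀ p, ‖p‖ ^ k * ‖partialFourierFun H p‖ ≤ C := by
  have hfst : ∃ C, ∀ p : ℝ × ℝ, ‖p.1‖ ^ k * ‖partialFourierFun H p‖ ≤ C := by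
    obtain ⟨C, hC⟩ := exists_bound_partialFourierFun
      (smulLeftCLM ℂ (fun q : ℝ × ℝ => (q.2 : ℂ) ^ k) H)
    refine ⟨C, fun p => le_trans (le_of_eq ?_) (hC p)⟩
    have : partialFourierFun (smulLeftCLM ℂ (fun q : ℝ × ℝ => (q.2 : ℂ) ^ k) H) p =
        (p.1 : ℂ) ^ k * partialFourierFun H p := by
      unfold partialFourierFun
      rw [← integral_const_mul]
      refine integral_congr_ae (Filter.Eventually.of_forall fun t => ?_)
      simp only [smulLeftCLM_apply_apply (hasTemperateGrowth_sndPow k), smul_eq_mul]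
      ring
    rw [this, norm_mul, norm_pow, Complex.norm_real]
  have hsnd : ∃ C, ∀ p : ℝ × ℝ, ‖p.2‖ ^ k * ‖partialFourierFun H p‖ ≤ C := by
    have hC : ∀ (k : ℕ) (H : 𝓢(ℝ × ℝ, ℂ)),
        ∃ C, ∀ p : ℝ × ℝ, ‖p.2‖ ^ k * ‖partialFourierFun H p‖ ≤ C := by
      intro k
      induction k with
      | zero => intro H; simpa using exists_bound_partialFourierFun H
      | succ k ih =>
        intro H
        obtain ⟨C, hC⟩ := ih (∂_{((1, 0) : ℝ × ℝ)} H)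
        refine ⟨C, fun p => le_trans ?_ (hC p)⟩
        rw [partialFourierFun_lineDeriv, norm_mul, pow_succ, mul_assoc]
        gcongr
        have : ‖2 * (π : ℂ) * Complex.I * p.2‖ = 2 * π * ‖p.2‖ := by
          simp [abs_of_pos Real.pi_pos]
        rw [this]
        nlinarith [Real.pi_gt_three, norm_nonneg p.2]
    exact hC k H
  obtain ⟨C₁, h₁⟩ := hfst
  obtain ⟨C₂, h₂⟩ := hsnd
  refine ⟨max C₁ C₂, fun p => ?_⟩
  rw [Prod.norm_def]
  rcases max_choice ‖p.1‖ ‖p.2‖ with h | h <;> rw [h]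
  · exact (h₁ p).trans (le_max_left _ _)
  · exact (h₂ p).trans (le_max_right _ _)

theorem partialFourierFun_decay (n : ℕ) : ∀ H : 𝓢(ℝ × ℝ, ℂ),
    ContDiff ℝ n (partialFourierFun H) ∧
    ∀ k : ℕ, ∃ C, ∀ p, ‖p‖ ^ k * ‖iteratedFDeriv ℝ n (partialFourierFun H) p‖ ≤ C := by
  induction n with
  | zero =>
    intro H
    refine ⟨contDiff_zero.2 (continuous_iff_continuousAt.2 fun p =>
      (hasFDerivAt_partialFourierFun H p).continuousAt), fun k => ?_⟩
    simpa using exists_pow_mul_bound_partialFourierFun k H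
  | succ n ih =>
    intro H
    set H₁ := ∂_{((0, 1) : ℝ × ℝ)} H with hH₁
    set H₂ := smulLeftCLM ℂ (fun q : ℝ × ℝ => (-2 * π * Complex.I) * (q.1 : ℂ)) H with hH₂
    set L₁ := ContinuousLinearMap.smulRightL ℝ (ℝ × ℝ) ℂ (ContinuousLinearMap.fst ℝ ℝ ℝ)
    set L₂ := ContinuousLinearMap.smulRightL ℝ (ℝ × ℝ) ℂ (ContinuousLinearMap.snd ℝ ℝ ℝ)
    have hf : fderiv ℝ (partialFourierFun H) =
        fun p => (L₁ ∘ partialFourierFun H₁) p + (L₂ ∘ partialFourierFun H₂) p := by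
      funext p; exact (hasFDerivAt_partialFourierFun H p).fderiv
    obtain ⟨c₁, d₁⟩ := ih H₁
    obtain ⟨c₂, d₂⟩ := ih H₂
    refine ⟨?_, fun k => ?_⟩
    · rw [Nat.cast_succ, contDiff_succ_iff_fderiv]
      refine ⟨fun p => (hasFDerivAt_partialFourierFun H p).differentiableAt, by simp, ?_⟩
      rw [hf]
      exact (L₁.contDiff.comp c₁).add (L₂.contDiff.comp c₂)
    · obtain ⟨C₁, h₁⟩ := d₁ k
      obtain ⟨C₂, h₂⟩ := d₂ k
      refine ⟨‖L₁‖ * C₁ + ‖L₂‖ * C₂, fun p => ?_⟩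
      rw [← norm_iteratedFDeriv_fderiv, hf]
      have e : iteratedFDeriv ℝ n
          (fun p => (L₁ ∘ partialFourierFun H₁) p + (L₂ ∘ partialFourierFun H₂) p) p = _ :=
        iteratedFDeriv_add_apply (L₁.contDiff.comp c₁).contDiffAt
          (L₂.contDiff.comp c₂).contDiffAt
      rw [e, L₁.iteratedFDeriv_comp_left c₁.contDiffAt le_rfl,
        L₂.iteratedFDeriv_comp_left c₂.contDiffAt le_rfl]
      calc _ ≤ ‖p‖ ^ k * (‖L₁‖ * ‖iteratedFDeriv ℝ n (partialFourierFun H₁) p‖ +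
            ‖L₂‖ * ‖iteratedFDeriv ℝ n (partialFourierFun H₂) p‖) := by
            gcongr
            exact (norm_add_le _ _).trans (add_le_add
              (L₁.norm_compContinuousMultilinearMap_le _)
              (L₂.norm_compContinuousMultilinearMap_le _))
        _ = ‖L₁‖ * (‖p‖ ^ k * ‖iteratedFDeriv ℝ n (partialFourierFun H₁) p‖) +
            ‖L₂‖ * (‖p‖ ^ k * ‖iteratedFDeriv ℝ n (partialFourierFun H₂) p‖) := by ring
        _ ≤ _ := by
            gcongr
            · exact h₁ p
            · exact h₂ p

/-- The partial Fourier transform as a Schwartz function. -/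
def partialFourier (H : 𝓢(ℝ × ℝ, ℂ)) : 𝓢(ℝ × ℝ, ℂ) where
  toFun := partialFourierFun H
  smooth' := contDiff_infty.2 fun n => (partialFourierFun_decay n H).1
  decay' k n := (partialFourierFun_decay n H).2 k

theorem partialFourier_apply (H : 𝓢(ℝ × ℝ, ℂ)) (p : ℝ × ℝ) :
    partialFourier H p = ∫ t : ℝ, H (t, p.1) * fourierKernel t p.2 := rfl

/-! ### Short-time Fourier transform and Wigner distribution of Schwartz functions -/

/-- The complex conjugate of a Schwartz function. -/
def conjSchwartz {E : Type*} [NormedAddCommGroup E] [NormedSpace ℝ E] (f : 𝓢(E, ℂ)) : 𝓢(E, ℂ) :=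
  f.postcompCLM (𝕜 := ℝ) (Complex.conjCLE : ℂ →L[ℝ] ℂ)

theorem conjSchwartz_apply {E : Type*} [NormedAddCommGroup E] [NormedSpace ℝ E] (f : 𝓢(E, ℂ))
    (u : E) : conjSchwartz f u = (starRingEnd ℂ) (f u) := rfl

/-- The shear `(t, x) ↦ (t, t - x)`. -/
def shear : (ℝ × ℝ) ≃L[ℝ] (ℝ × ℝ) :=
  ContinuousLinearEquiv.equivOfInverse
    ((ContinuousLinearMap.fst ℝ ℝ ℝ).prod
      (ContinuousLinearMap.fst ℝ ℝ ℝ - ContinuousLinearMap.snd ℝ ℝ ℝ))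
    ((ContinuousLinearMap.fst ℝ ℝ ℝ).prod
      (ContinuousLinearMap.fst ℝ ℝ ℝ - ContinuousLinearMap.snd ℝ ℝ ℝ))
    (fun p => by ext <;> simp) (fun p => by ext <;> simp)

/-- The map `(t, x) ↦ (x + t / 2, x - t / 2)`. -/
def symmetricCoord : (ℝ × ℝ) ≃L[ℝ] (ℝ × ℝ) :=
  ContinuousLinearEquiv.equivOfInverse
    ((ContinuousLinearMap.snd ℝ ℝ ℝ + (1 / 2 : ℝ) • ContinuousLinearMap.fst ℝ ℝ ℝ).prod
      (ContinuousLinearMap.snd ℝ ℝ ℝ - (1 / 2 : ℝ) • ContinuousLinearMap.fst ℝ ℝ ℝ))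
    ((ContinuousLinearMap.fst ℝ ℝ ℝ - ContinuousLinearMap.snd ℝ ℝ ℝ).prod
      ((1 / 2 : ℝ) • (ContinuousLinearMap.fst ℝ ℝ ℝ + ContinuousLinearMap.snd ℝ ℝ ℝ)))
    (fun p => by ext <;> simp <;> ring) (fun p => by ext <;> simp <;> ring)

/-- `V_g f` for Schwartz functions `f` and `g`, as a Schwartz function. -/
def stftSchwartz (g f : 𝓢(ℝ, ℂ)) : 𝓢(ℝ × ℝ, ℂ) :=
  partialFourier (compCLMOfContinuousLinearEquiv ℂ shear (tensor f (conjSchwartz g)))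

/-- `W(f, g)` for Schwartz functions `f` and `g`, as a Schwartz function. -/
def wignerSchwartz (f g : 𝓢(ℝ, ℂ)) : 𝓢(ℝ × ℝ, ℂ) :=
  partialFourier (compCLMOfContinuousLinearEquiv ℂ symmetricCoord (tensor f (conjSchwartz g)))

theorem wignerSchwartz_apply (f g : 𝓢(ℝ, ℂ)) (p : ℝ × ℝ) :
    wignerSchwartz f g p = wigner f g p := by
  refine integral_congr_ae (Filter.Eventually.of_forall fun t => ?_)
  have : compCLMOfContinuousLinearEquiv ℂ symmetricCoord (tensor f (conjSchwartz g)) (t, p.1) =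
    f (p.1 + (1 / 2 : ℝ) • t) * (starRingEnd ℂ) (g (p.1 - (1 / 2 : ℝ) • t)) := rfl
  simp only [this, fourierKernel, smul_eq_mul]
  rw [show (1 / 2 : ℝ) * t = t / 2 by ring]

/-! ### The Japanese bracket -/

theorem japanese_sq (p : ℝ × ℝ) : japanese p ^ 2 = 1 + p.1 ^ 2 + p.2 ^ 2 :=
  Real.sq_sqrt (by positivity)

theorem one_le_japanese (p : ℝ × ℝ) : 1 ≤ japanese p :=
  Real.one_le_sqrt.2 (by nlinarith [sq_nonneg p.1, sq_nonneg p.2])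

theorem japanese_pos (p : ℝ × ℝ) : 0 < japanese p := zero_lt_one.trans_le (one_le_japanese p)

theorem continuous_japanese : Continuous japanese := by unfold japanese; fun_prop

theorem japanese_neg (p : ℝ × ℝ) : japanese (-p) = japanese p := by simp [japanese]

theorem japanese_le_of_abs_le {p q : ℝ × ℝ} (h₁ : |p.1| ≤ |q.1|) (h₂ : |p.2| ≤ |q.2|) :
    japanese p ≤ japanese q := by
  have := sq_le_sq.2 h₁
  have := sq_le_sq.2 h₂
  exact Real.sqrt_le_sqrt (by linarith)

theorem japanese_add_le (p q : ℝ × ℝ) : japanese (p + q) ≤ japanese p + japanese q := by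
  have h1 : p.1 * q.1 + p.2 * q.2 ≤ japanese p * japanese q := by
    refine le_of_sq_le_sq ?_ (mul_pos (japanese_pos p) (japanese_pos q)).le
    rw [mul_pow, japanese_sq, japanese_sq]
    nlinarith [sq_nonneg (p.1 * q.2 - p.2 * q.1), sq_nonneg p.1, sq_nonneg p.2, sq_nonneg q.1,
      sq_nonneg q.2]
  refine le_of_sq_le_sq ?_ (add_pos (japanese_pos p) (japanese_pos q)).le
  rw [add_sq, japanese_sq, japanese_sq, japanese_sq]
  simp only [Prod.fst_add, Prod.snd_add]
  nlinarith

theorem one_add_norm_le_japanese (p : ℝ × ℝ) : 1 + ‖p‖ ≤ 2 * japanese p := by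
  have h1 : ‖p‖ ≤ japanese p := by
    refine le_of_sq_le_sq ?_ (japanese_pos p).le
    rw [japanese_sq, Prod.norm_def]
    rcases max_choice ‖p.1‖ ‖p.2‖ with h | h <;> rw [h, Real.norm_eq_abs, sq_abs] <;>
      nlinarith [sq_nonneg p.1, sq_nonneg p.2]
  linarith [one_le_japanese p]

theorem japanese_le_one_add_norm (p : ℝ × ℝ) : japanese p ≤ 2 * (1 + ‖p‖) := by
  have h1 : |p.1| ≤ ‖p‖ := le_max_left _ _
  have h2 : |p.2| ≤ ‖p‖ := le_max_right _ _
  have h3 := sq_le_sq' (by linarith [neg_abs_le p.1]) ((le_abs_self _).trans h1)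
  have h4 := sq_le_sq' (by linarith [neg_abs_le p.2]) ((le_abs_self _).trans h2)
  refine le_of_sq_le_sq ?_ (by positivity)
  rw [japanese_sq]
  nlinarith [norm_nonneg p]

/-- The polynomial weight `⟨p⟩^{-s}`. -/
def weight (s : ℝ) (p : ℝ × ℝ) : ℝ := japanese p ^ (-s)

theorem weight_pos (s : ℝ) (p : ℝ × ℝ) : 0 < weight s p := Real.rpow_pos_of_pos (japanese_pos p) _

theorem weight_neg (s : ℝ) (p : ℝ × ℝ) : weight s (-p) = weight s p := by
  rw [weight, japanese_neg, weight]

theorem weight_sub_comm (s : ℝ) (p q : ℝ × ℝ) : weight s (p - q) = weight s (q - p) := by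
  rw [← weight_neg, neg_sub]

theorem continuous_weight (s : ℝ) : Continuous (weight s) :=
  continuous_japanese.rpow_const fun p => Or.inl (japanese_pos p).ne'

theorem weight_le_of_le {s : ℝ} (hs : 0 ≤ s) {p q : ℝ × ℝ} {c : ℝ} (hc : 0 < c)
    (h : japanese q ≤ c * japanese p) : weight s p ≤ c ^ s * weight s q := by
  have h1 : weight s (p) = c ^ s * (c * japanese p) ^ (-s) := by
    rw [Real.mul_rpow hc.le (japanese_pos p).le, ← mul_assoc, ← Real.rpow_add hc]
    simp [weight]
  rw [h1]
  exact mul_le_mul_of_nonneg_left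
    (Real.rpow_le_rpow_of_nonpos (japanese_pos q) h (by linarith)) (by positivity)

theorem weight_mono {s : ℝ} (hs : 0 ≤ s) {p q : ℝ × ℝ} (h₁ : |q.1| ≤ |p.1|)
    (h₂ : |q.2| ≤ |p.2|) : weight s p ≤ weight s q := by
  simpa using weight_le_of_le hs one_pos (by simpa using japanese_le_of_abs_le h₁ h₂)

/-- The plane has dimension 2, hence the condition s > 2. -/
theorem integrable_weight {s : ℝ} (hs : 2 < s) : Integrable (weight s) := by
  have h : Integrable (fun p : ℝ × ℝ => (1 + ‖p‖) ^ (-s)) :=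
    integrable_one_add_norm (by simpa using hs)
  refine (h.const_mul (2 ^ s)).mono' (continuous_weight s).aestronglyMeasurable
    (Filter.Eventually.of_forall fun p => ?_)
  rw [Real.norm_of_nonneg (weight_pos s p).le]
  have hp : 0 < 1 + ‖p‖ := by positivity
  have h1 : (2 : ℝ) ^ s * (1 + ‖p‖) ^ (-s) = ((1 + ‖p‖) / 2) ^ (-s) := by
    rw [Real.div_rpow hp.le zero_le_two, Real.rpow_neg zero_le_two, div_inv_eq_mul, mul_comm]
  rw [h1]
  exact Real.rpow_le_rpow_of_nonpos (by positivity)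
    (by linarith [one_add_norm_le_japanese p]) (by linarith)

/-- The larger of ⟨z-a⟩ and ⟨z-b⟩ is at least ⟨a-b⟩/2, so the smaller weight contributes 2^s
⟨a-b⟩^{-s} and the other one remains to be integrated over z. -/
theorem weight_mul_weight_le {s : ℝ} (hs : 0 ≤ s) (z a b : ℝ × ℝ) :
    weight s (z - a) * weight s (z - b) ≤
      2 ^ s * weight s (a - b) * (weight s (z - a) + weight s (z - b)) := by
  have h : japanese (a - b) ≤ japanese (z - a) + japanese (z - b) := by
    have h1 : a - b = -(z - a) + (z - b) := by abel
    rw [h1]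
    exact (japanese_add_le _ _).trans_eq (by rw [japanese_neg])
  have pa := weight_pos s (z - a)
  have pb := weight_pos s (z - b)
  have pc : 0 < 2 ^ s * weight s (a - b) := mul_pos (by positivity) (weight_pos s _)
  rcases le_total (japanese (z - a)) (japanese (z - b)) with h' | h'
  · have h2 : weight s (z - b) ≤ 2 ^ s * weight s (a - b) :=
      weight_le_of_le hs two_pos (by linarith)
    nlinarith
  · have h2 : weight s (z - a) ≤ 2 ^ s * weight s (a - b) :=
      weight_le_of_le hs two_pos (by linarith)
    nlinarith

theorem integrable_weight_mul_weight {s : ℝ} (hs : 2 < s) (a b : ℝ × ℝ) :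
    Integrable (fun z => weight s (z - a) * weight s (z - b)) := by
  have h0 := integrable_weight hs
  refine (((h0.comp_sub_right a).add (h0.comp_sub_right b)).const_mul
    (2 ^ s * weight s (a - b))).mono' ?_ (Filter.Eventually.of_forall fun z => ?_)
  · exact (((continuous_weight s).comp (continuous_sub_right a)).mul
      ((continuous_weight s).comp (continuous_sub_right b))).aestronglyMeasurable
  · rw [Real.norm_of_nonneg (mul_pos (weight_pos s _) (weight_pos s _)).le]
    exact weight_mul_weight_le (by linarith) z a b

/-- The weight is subconvolutive. Every off-diagonal estimate below is an instance of this. -/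
theorem exists_integral_weight_mul_weight_le {s : ℝ} (hs : 2 < s) :
    ∃ C : ℝ, 0 ≤ C ∧ ∀ a b : ℝ × ℝ,
      ∫ z, weight s (z - a) * weight s (z - b) ≤ C * weight s (a - b) := by
  have h0 := integrable_weight hs
  have hI : 0 ≤ ∫ z, weight s z := integral_nonneg fun z => (weight_pos s z).le
  refine ⟨2 ^ s * (2 * ∫ z, weight s z), by positivity, fun a b => ?_⟩
  have h1 := h0.comp_sub_right a
  have h2 := h0.comp_sub_right b
  calc ∫ z, weight s (z - a) * weight s (z - b)
      ≤ ∫ z, 2 ^ s * weight s (a - b) * (weight s (z - a) + weight s (z - b)) :=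
        integral_mono (integrable_weight_mul_weight hs a b) ((h1.add h2).const_mul _)
          fun z => weight_mul_weight_le (by linarith) z a b
    _ = 2 ^ s * weight s (a - b) * ((∫ z, weight s z) + ∫ z, weight s z) := by
        rw [integral_const_mul, integral_add h1 h2, integral_sub_right_eq_self (weight s) a,
          integral_sub_right_eq_self (weight s) b]
    _ = _ := by ring

theorem exists_bound_weight_of_schwartz (s : ℝ) (H : 𝓢(ℝ × ℝ, ℂ)) :
    ∃ C : ℝ, ∀ p, ‖H p‖ ≤ C * weight s p := by
  obtain ⟨n, hn⟩ := exists_nat_ge s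
  refine ⟨2 ^ n * (2 ^ n * (Finset.Iic (n, 0)).sup (schwartzSeminormFamily ℝ (ℝ × ℝ) ℂ) H),
    fun p => ?_⟩
  have h1 := SchwartzMap.one_add_le_sup_seminorm_apply (𝕜 := ℝ) (m := (n, 0)) (k := n) (n := 0)
    le_rfl le_rfl H p
  rw [norm_iteratedFDeriv_zero] at h1
  have h2 : japanese p ^ s ≤ 2 ^ n * (1 + ‖p‖) ^ n := by
    rw [← mul_pow]
    calc japanese p ^ s ≤ japanese p ^ (n : ℝ) :=
          Real.rpow_le_rpow_of_exponent_le (one_le_japanese p) hn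
      _ = japanese p ^ n := Real.rpow_natCast _ _
      _ ≤ _ := pow_le_pow_left₀ (japanese_pos p).le (japanese_le_one_add_norm p) n
  have h3 : 0 < japanese p ^ s := Real.rpow_pos_of_pos (japanese_pos p) _
  rw [weight, Real.rpow_neg (japanese_pos p).le, ← div_eq_mul_inv, le_div_iff₀ h3]
  calc ‖H p‖ * japanese p ^ s ≤ ‖H p‖ * (2 ^ n * (1 + ‖p‖) ^ n) := by gcongr
    _ = 2 ^ n * ((1 + ‖p‖) ^ n * ‖H p‖) := by ring
    _ ≤ _ := mul_le_mul_of_nonneg_left h1 (by positivity)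

/-! ### The amalgam space -/

/-- A point of a cell differs from the corner by at most α and 1/(2α) in the coordinates, so the
triangle inequality makes the two brackets comparable uniformly in the cell. -/
theorem japanese_le_latticePoint {α : ℝ} (hα : 0 < α) {m n : ℤ} {p : ℝ × ℝ}
    (hp : p ∈ latticeCell α m n) :
    japanese p ≤ (1 + japanese (α, 1 / (2 * α))) * japanese (latticePoint α m n) ∧
    japanese (latticePoint α m n) ≤ (1 + japanese (α, 1 / (2 * α))) * japanese p := by
  obtain ⟨⟨h1, h2⟩, h3, h4⟩ := hp
  have hα' : 0 < 1 / (2 * α) := by positivity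
  rw [add_div] at h4
  have hq : japanese (p - latticePoint α m n) ≤ japanese (α, 1 / (2 * α)) := by
    refine japanese_le_of_abs_le ?_ ?_
    · simp only [Prod.fst_sub, latticePoint]
      rw [abs_of_nonneg (by linarith), abs_of_pos hα]; linarith
    · simp only [Prod.snd_sub, latticePoint]
      rw [abs_of_nonneg (by linarith), abs_of_pos hα']; linarith
  have hD := (japanese_pos (α, 1 / (2 * α))).le
  constructor
  · have := japanese_add_le (latticePoint α m n) (p - latticePoint α m n)
    rw [add_sub_cancel] at this
    nlinarith [one_le_japanese (latticePoint α m n)]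
  · have := japanese_add_le p (-(p - latticePoint α m n))
    rw [japanese_neg, neg_sub, add_sub_cancel] at this
    nlinarith [one_le_japanese p]

theorem exists_mem_latticeCell {α : ℝ} (hα : 0 < α) (p : ℝ × ℝ) :
    ∃ m n : ℤ, p ∈ latticeCell α m n := by
  refine ⟨⌊p.1 / α⌋, ⌊p.2 * (2 * α)⌋, ⟨?_, ?_⟩, ?_, ?_⟩
  · have := Int.floor_le (p.1 / α)
    rwa [le_div_iff₀' hα] at this
  · have := Int.lt_floor_add_one (p.1 / α)
    rwa [div_lt_iff₀' hα] at this
  · rw [div_le_iff₀ (by positivity)]; exact Int.floor_le _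
  · rw [lt_div_iff₀ (by positivity)]; exact Int.lt_floor_add_one _

/-- Countably many cells cover the plane, and on each the weight is comparable to its value at the
corner. Only this pointwise form of the amalgam condition is used later. -/
theorem MemAmalgam.exists_ae_bound {α : ℝ} (hα : 0 < α) {N : ℕ} {F : ℝ × ℝ → ℂ}
    (h : MemAmalgam α N F) : ∃ K : ℝ, ∀ᵐ p, ‖F p‖ ≤ K * weight N p := by
  set D := 1 + japanese (α, 1 / (2 * α)) with hD
  have hD0 : 0 < D := by have := japanese_pos (α, 1 / (2 * α)); linarith
  set K := (amalgamNorm α N F).toReal with hK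
  refine ⟨D ^ (N : ℝ) * K, ?_⟩
  have hcell : ∀ m n : ℤ, ∀ᵐ p, p ∈ latticeCell α m n → ‖F p‖ ≤ D ^ (N : ℝ) * K * weight N p := by
    intro m n
    have hms : MeasurableSet (latticeCell α m n) := measurableSet_Ico.prod measurableSet_Ico
    rw [← ae_restrict_iff' hms]
    filter_upwards [ae_le_essSup (f := fun p => ‖F p‖ₑ) (μ := volume.restrict (latticeCell α m n)),
      ae_restrict_mem hms] with p hp hpm
    have h1 : ‖F p‖ₑ * ENNReal.ofReal (japanese (latticePoint α m n) ^ N) ≤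
        amalgamNorm α N F :=
      (mul_le_mul_left hp _).trans (le_iSup₂ (f := fun m n : ℤ =>
        essSup (fun p => ‖F p‖ₑ) (volume.restrict (latticeCell α m n)) *
          ENNReal.ofReal (japanese (latticePoint α m n) ^ N)) m n)
    have h2 : ‖F p‖ * japanese (latticePoint α m n) ^ N ≤ K := by
      have := ENNReal.toReal_mono h.ne h1
      rwa [ENNReal.toReal_mul, toReal_enorm, ENNReal.toReal_ofReal
        (pow_nonneg (japanese_pos _).le N)] at this
    have h3 : ‖F p‖ ≤ K * weight N (latticePoint α m n) := by
      rw [weight, Real.rpow_neg (japanese_pos _).le, Real.rpow_natCast, ← div_eq_mul_inv,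
        le_div_iff₀ (pow_pos (japanese_pos _) N)]
      exact h2
    have h4 : weight N (latticePoint α m n) ≤ D ^ (N : ℝ) * weight N p :=
      weight_le_of_le (Nat.cast_nonneg N) hD0 (japanese_le_latticePoint hα hpm).1
    calc ‖F p‖ ≤ K * weight N (latticePoint α m n) := h3
      _ ≤ K * (D ^ (N : ℝ) * weight N p) := by gcongr
      _ = _ := by ring
  filter_upwards [ae_all_iff.2 fun m => ae_all_iff.2 fun n => hcell m n] with p hp
  obtain ⟨m, n, hmn⟩ := exists_mem_latticeCell hα p
  exact hp m n hmn

theorem memAmalgam_of_bound {α : ℝ} (hα : 0 < α) {N : ℕ} {F : ℝ × ℝ → ℂ} {C : ℝ}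
    (h : ∀ p, japanese p ^ N * ‖F p‖ ≤ C) : MemAmalgam α N F := by
  set D := 1 + japanese (α, 1 / (2 * α)) with hD
  have hD0 : 0 < D := by have := japanese_pos (α, 1 / (2 * α)); linarith
  refine lt_of_le_of_lt (b := ENNReal.ofReal (D ^ N * C)) ?_ ENNReal.ofReal_lt_top
  refine iSup₂_le fun m n => ?_
  have hms : MeasurableSet (latticeCell α m n) := measurableSet_Ico.prod measurableSet_Ico
  have hl : 0 < japanese (latticePoint α m n) ^ N := pow_pos (japanese_pos _) N
  have h1 : essSup (fun p => ‖F p‖ₑ) (volume.restrict (latticeCell α m n)) ≤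
      ENNReal.ofReal (D ^ N * C / japanese (latticePoint α m n) ^ N) := by
    refine essSup_le_of_ae_le _ ?_
    filter_upwards [ae_restrict_mem hms] with p hp
    rw [← ofReal_norm]
    refine ENNReal.ofReal_le_ofReal ?_
    rw [le_div_iff₀ hl]
    calc ‖F p‖ * japanese (latticePoint α m n) ^ N ≤ ‖F p‖ * (D * japanese p) ^ N := by
          gcongr
          · exact (japanese_pos _).le
          · exact (japanese_le_latticePoint hα hp).2
      _ = D ^ N * (japanese p ^ N * ‖F p‖) := by rw [mul_pow]; ring
      _ ≤ _ := by gcongr; exact h p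
  refine (mul_le_mul_left h1 _).trans ?_
  have hC : 0 ≤ C := (by have := japanese_pos (0 : ℝ × ℝ); positivity : (0 : ℝ) ≤ _).trans (h 0)
  rw [← ENNReal.ofReal_mul (by positivity), div_mul_cancel₀ _ hl.ne']

/-! ### Bell functions -/

theorem exists_bound_iteratedDeriv {N : ℕ} {b : ℝ → ℂ} (hb : ContDiff ℝ N b)
    (hc : HasCompactSupport b) : ∃ M : ℝ, ∀ i ≤ N, ∀ t, ‖iteratedFDeriv ℝ i b t‖ ≤ M := by
  have h : ∀ i : ℕ, ∃ M : ℝ, 0 ≤ M ∧ (i ≤ N → ∀ t, ‖iteratedFDeriv ℝ i b t‖ ≤ M) := fun i => by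
    by_cases hi : i ≤ N
    · obtain ⟨M, hM⟩ := (hc.iteratedFDeriv (𝕜 := ℝ) i).exists_bound_of_continuous
        (hb.continuous_iteratedFDeriv (by exact_mod_cast hi))
      exact ⟨M, (norm_nonneg _).trans (hM 0), fun _ => hM⟩
    · exact ⟨0, le_rfl, fun h => absurd h hi⟩
  choose M hM0 hM using h
  exact ⟨∑ i ∈ Finset.range (N + 1), M i, fun i hi t => (hM i hi t).trans
    (Finset.single_le_sum (f := M) (fun i _ => hM0 i) (Finset.mem_range.2 (by omega)))⟩

/-- For |x| > 2R the supports of b and of its translate are disjoint. For the other x, N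
integrations by parts give decay |ξ|^{-N} with a constant independent of x. -/
theorem exists_bound_stft_self {N : ℕ} {b : ℝ → ℂ} (hb : ContDiff ℝ N b) {R : ℝ} (hR : 0 ≤ R)
    (hsupp : Function.support b ⊆ Set.Icc (-R) R) :
    ∃ C : ℝ, ∀ p, japanese p ^ N * ‖stft b b p‖ ≤ C := by
  have hc : HasCompactSupport b := HasCompactSupport.of_support_subset_isCompact isCompact_Icc hsupp
  obtain ⟨M, hM⟩ := exists_bound_iteratedDeriv hb hc
  have hM0 : 0 ≤ M := (norm_nonneg _).trans (hM 0 (Nat.zero_le _) 0)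
  set h : ℝ → ℝ → ℂ := fun x t => b t * (starRingEnd ℂ) (b (t - x)) with hh
  have hconj : ∀ x, ContDiff ℝ N fun t => (starRingEnd ℂ) (b (t - x)) := fun x =>
    Complex.conjCLE.contDiff.comp (hb.comp (contDiff_id.sub contDiff_const))
  have hsm : ∀ x, ContDiff ℝ N (h x) := fun x => hb.mul (hconj x)
  -- Leibniz: each of the two factors is bounded by M, and the binomial coefficients sum to 2^n ≤
  -- 2^N.
  have hbd : ∀ x, ∀ n ≤ N, ∀ t, ‖iteratedDeriv n (h x) t‖ ≤
      Set.indicator (Set.Icc (-R) R) (fun _ => 2 ^ N * (M * M)) t := by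
    intro x n hn t
    have hts : tsupport (h x) ⊆ Set.Icc (-R) R := by
      refine closure_minimal (fun t ht => hsupp ?_) isClosed_Icc
      exact left_ne_zero_of_mul ht
    by_cases ht : t ∈ Set.Icc (-R) R
    · rw [Set.indicator_of_mem ht, ← norm_iteratedFDeriv_eq_norm_iteratedDeriv]
      refine (norm_iteratedFDeriv_mul_le hb (hconj x) t (by exact_mod_cast hn)).trans ?_
      calc _ ≤ ∑ i ∈ Finset.range (n + 1), (n.choose i : ℝ) * M * M := by
            refine Finset.sum_le_sum fun i hi => ?_
            have hi' : i ≤ n := by simpa [Nat.lt_succ_iff] using hi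
            gcongr
            · exact hM i (by omega) t
            · have e1 : iteratedFDeriv ℝ (n - i) (fun t => (starRingEnd ℂ) (b (t - x))) t =
                  (Complex.conjCLE : ℂ →L[ℝ] ℂ).compContinuousMultilinearMap
                    (iteratedFDeriv ℝ (n - i) (fun t => b (t - x)) t) :=
                (Complex.conjCLE : ℂ →L[ℝ] ℂ).iteratedFDeriv_comp_left
                  (hb.comp (contDiff_id.sub contDiff_const)).contDiffAt
                  (by exact_mod_cast (Nat.sub_le n i).trans hn)
              rw [e1]
              refine ((Complex.conjCLE : ℂ →L[ℝ] ℂ).norm_compContinuousMultilinearMap_le _).trans ?_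
              rw [iteratedFDeriv_comp_sub]
              refine (mul_le_of_le_one_left (norm_nonneg _) ?_).trans (hM _ (by omega) _)
              exact ContinuousLinearMap.opNorm_le_bound _ zero_le_one fun z => by simp
        _ = 2 ^ n * (M * M) := by
            simp_rw [mul_assoc]
            rw [← Finset.sum_mul, ← Nat.cast_sum, Nat.sum_range_choose]
            push_cast; ring
        _ ≤ _ := by
            gcongr
            exact one_le_two
    · rw [Set.indicator_of_notMem ht, ← norm_iteratedFDeriv_eq_norm_iteratedDeriv,
        image_eq_zero_of_notMem_tsupport (fun h' => ht (hts (tsupport_iteratedFDeriv_subset n h')))]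
      simp
  have hind : Integrable (Set.indicator (Set.Icc (-R) R) fun _ : ℝ => 2 ^ N * (M * M)) :=
    (integrable_indicator_iff measurableSet_Icc).2 (integrableOn_const (by simp))
  have hint : ∀ x, ∀ n : ℕ, n ≤ N → Integrable (iteratedDeriv n (h x)) := fun x n hn =>
    hind.mono' ((hsm x).continuous_iteratedDeriv n (by exact_mod_cast hn)).aestronglyMeasurable
      (Filter.Eventually.of_forall (hbd x n hn))
  set I := ∫ t, Set.indicator (Set.Icc (-R) R) (fun _ : ℝ => 2 ^ N * (M * M)) t with hI
  have hstft : ∀ p, stft b b p = FourierTransform.fourier (h p.1) p.2 := fun p => by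
    rw [fourier_eq_integral_kernel]; rfl
  have hn0 : ∀ (f : ℝ → ℂ) (ξ : ℝ), (∀ t, ‖f t‖ ≤
      Set.indicator (Set.Icc (-R) R) (fun _ => 2 ^ N * (M * M)) t) →
      ‖FourierTransform.fourier f ξ‖ ≤ I := fun f ξ hf => by
    rw [fourier_eq_integral_kernel]
    refine norm_integral_le_of_norm_le hind (Filter.Eventually.of_forall fun t => ?_)
    rw [norm_mul, norm_fourierKernel, mul_one]; exact hf t
  have b0 : ∀ p, ‖stft b b p‖ ≤ I := fun p => by
    rw [hstft]
    exact hn0 _ _ (by simpa using hbd p.1 0 (Nat.zero_le _))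
  have bN : ∀ p : ℝ × ℝ, |p.2| ^ N * ‖stft b b p‖ ≤ I := fun p => by
    have key := congrFun (Real.fourier_iteratedDeriv (N := (N : ℕ∞)) (n := N) (hsm p.1)
      (fun n hn => hint p.1 n (by exact_mod_cast hn)) le_rfl) p.2
    have h1 := hn0 (iteratedDeriv N (h p.1)) p.2 (hbd p.1 N le_rfl)
    rw [key, norm_smul, ← hstft, norm_pow] at h1
    refine le_trans ?_ h1
    gcongr
    have : ‖2 * (π : ℂ) * Complex.I * p.2‖ = 2 * π * |p.2| := by
      simp [abs_of_pos Real.pi_pos]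
    rw [this]
    nlinarith [Real.pi_gt_three, abs_nonneg p.2]
  have hI0 : 0 ≤ I := (norm_nonneg _).trans (b0 0)
  -- If |x| ≤ 2R then ⟨p⟩ ≤ 1 + 2R + |ξ|, which is at most 2 + 2R for |ξ| ≤ 1 and at most (2 +
  -- 2R)|ξ| for |ξ| ≥ 1.
  refine ⟨(2 + 2 * R) ^ N * I, fun p => ?_⟩
  by_cases hp : |p.1| ≤ 2 * R
  · have hj : japanese p ≤ (1 + 2 * R) + |p.2| := by
      refine le_of_sq_le_sq ?_ (by positivity)
      rw [japanese_sq]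
      nlinarith [sq_abs p.1, sq_abs p.2, abs_nonneg p.1, abs_nonneg p.2]
    rcases le_total |p.2| 1 with h1 | h1
    · have hle : japanese p ≤ 2 + 2 * R := by linarith
      exact mul_le_mul (pow_le_pow_left₀ (japanese_pos p).le hle N) (b0 p) (norm_nonneg _)
        (by positivity)
    · calc japanese p ^ N * ‖stft b b p‖ ≤ ((2 + 2 * R) * |p.2|) ^ N * ‖stft b b p‖ := by
            gcongr
            · exact (japanese_pos p).le
            · nlinarith
        _ = (2 + 2 * R) ^ N * (|p.2| ^ N * ‖stft b b p‖) := by rw [mul_pow]; ring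
        _ ≤ _ := by gcongr; exact bN p
  · have hz : ∀ t, h p.1 t = 0 := fun t => by
      by_contra hne
      have h1 := hsupp (left_ne_zero_of_mul hne)
      have h2 : t - p.1 ∈ Set.Icc (-R) R := hsupp fun h0 => right_ne_zero_of_mul hne (by simp [h0])
      exact hp (abs_le.2 ⟨by linarith [h1.1, h2.2], by linarith [h1.2, h2.1]⟩)
    have : stft b b p = 0 := by
      rw [hstft, fourier_eq_integral_kernel]; simp [hz]
    rw [this, norm_zero, mul_zero]
    positivity

theorem hasDerivAt_integral_Iic {ζ : ℝ → ℝ} (hc : Continuous ζ) (hi : Integrable ζ) (t : ℝ) :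
    HasDerivAt (fun t => ∫ u in Set.Iic t, ζ u) (ζ t) t := by
  have h : (fun t => ∫ u in Set.Iic t, ζ u) =
      fun t => (∫ u in (0 : ℝ)..t, ζ u) + ∫ u in Set.Iic 0, ζ u := by
    funext t
    rw [← intervalIntegral.integral_Iic_sub_Iic hi.integrableOn hi.integrableOn]
    ring
  rw [h]
  exact (intervalIntegral.integral_hasDerivAt_right (hc.intervalIntegrable _ _)
    (hc.stronglyMeasurableAtFilter _ _) hc.continuousAt).add_const _

/-- θ gains one derivative over ζ. It vanishes left of -ε, which kills the sine, and equals π/2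
right of ε, which kills the cosine for t > α + ε; the interval [-2α, 2α] is a convenient
enlargement. -/
theorem IsBellFunction.contDiff_and_support {α : ℝ} {N : ℕ} (hN : 1 ≤ N) {b : ℝ → ℝ}
    (h : IsBellFunction α N b) :
    ContDiff ℝ N b ∧ Function.support b ⊆ Set.Icc (-(2 * α)) (2 * α) := by
  obtain ⟨ε, ζ, hε, hεα, hζ, -, hsupp, hint, hb⟩ := h
  have hi : Integrable ζ := hζ.continuous.integrable_of_hasCompactSupport
    (HasCompactSupport.of_support_subset_isCompact isCompact_Icc hsupp)
  set θ : ℝ → ℝ := fun t => ∫ u in Set.Iic t, ζ u with hθ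
  have hd := hasDerivAt_integral_Iic hζ.continuous hi
  have hθN : ContDiff ℝ N θ := by
    obtain ⟨n, rfl⟩ : ∃ n, N = n + 1 := ⟨N - 1, by omega⟩
    rw [Nat.cast_succ, contDiff_succ_iff_deriv]
    refine ⟨fun t => (hd t).differentiableAt, by simp, ?_⟩
    rw [show deriv θ = ζ from funext fun t => (hd t).deriv]
    simpa using hζ
  have hbe : b = fun t => Real.sin (θ t) * Real.cos (θ (t - α)) := funext hb
  constructor
  · rw [hbe]
    exact (Real.contDiff_sin.comp hθN).mul
      (Real.contDiff_cos.comp (hθN.comp (contDiff_id.sub contDiff_const)))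
  · intro t ht
    by_contra hn
    refine ht ?_
    rw [Set.mem_Icc, not_and_or, not_le, not_le] at hn
    rcases hn with hn | hn
    · have h0 : θ t = 0 := by
        refine setIntegral_eq_zero_of_forall_eq_zero fun u hu => ?_
        by_contra h'
        have := (hsupp h').1
        linarith [Set.mem_Iic.1 hu]
      rw [hbe]; simp [h0]
    · have h0 : θ (t - α) = π / 2 := by
        rw [hθ, ← hint]
        refine setIntegral_eq_integral_of_forall_compl_eq_zero fun u hu => ?_
        by_contra h'
        have := (hsupp h').2
        rw [Set.mem_Iic, not_le] at hu
        linarith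
      rw [hbe]; simp [h0]

theorem IsBellFunction.memLp_and_memAmalgam {α : ℝ} (hα : 0 < α) {N : ℕ} (hN : 1 ≤ N) {b : ℝ → ℝ}
    (h : IsBellFunction α N b) :
    MemLp (fun t => (b t : ℂ)) 2 volume ∧
      MemAmalgam α N (stft (fun t => (b t : ℂ)) (fun t => (b t : ℂ))) := by
  obtain ⟨h1, h2⟩ := h.contDiff_and_support hN
  have h3 : ContDiff ℝ N fun t => (b t : ℂ) := Complex.ofRealCLM.contDiff.comp h1
  have h4 : Function.support (fun t => (b t : ℂ)) ⊆ Set.Icc (-(2 * α)) (2 * α) :=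
    fun t ht => h2 fun h0 => ht (by simp [h0])
  refine ⟨h3.continuous.memLp_of_hasCompactSupport
    (HasCompactSupport.of_support_subset_isCompact isCompact_Icc h4), ?_⟩
  obtain ⟨C, hC⟩ := exists_bound_stft_self h3 (by positivity) h4
  exact memAmalgam_of_bound hα hC

/-! ### Time-frequency shifts -/

/-- The unimodular number `e^{-2πi r}`. -/
def phase (r : ℝ) : ℂ := Complex.exp (-2 * π * Complex.I * r)

theorem phase_add (r s : ℝ) : phase (r + s) = phase r * phase s := by
  rw [phase, phase, phase, ← Complex.exp_add]; push_cast; ring_nf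

theorem conj_phase (r : ℝ) : conj (phase r) = phase (-r) := by
  rw [phase, phase, ← Complex.exp_conj]; simp [Complex.conj_ofNat]

theorem fourierKernel_eq_phase (t ξ : ℝ) : fourierKernel t ξ = phase (t * ξ) := by
  rw [fourierKernel, phase]; push_cast; ring_nf

theorem norm_phase (r : ℝ) : ‖phase r‖ = 1 := by
  rw [← mul_one r, ← fourierKernel_eq_phase, norm_fourierKernel]

theorem continuous_phase : Continuous phase := by unfold phase; fun_prop

theorem hasTemperateGrowth_phase {E : Type*} [NormedAddCommGroup E] [NormedSpace ℝ E] {Q : E → ℝ}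
    (hQ : Function.HasTemperateGrowth Q) : Function.HasTemperateGrowth fun x => phase (Q x) := by
  have h := (hasTemperateGrowth_conjCharacter (1, 0)).comp
    ((ContinuousLinearMap.inl ℝ ℝ ℝ).hasTemperateGrowth.comp hQ)
  convert h using 1
  funext x
  simp [phase, conjCharacter]

/-- The time-frequency shift `t ↦ e^{2πi ξt} f(t - x)` of a Schwartz function. -/
def tfShift (z : ℝ × ℝ) (f : 𝓢(ℝ, ℂ)) : 𝓢(ℝ, ℂ) :=
  smulLeftCLM ℂ (fun t : ℝ => phase (-(z.2 * t))) (f.compSubConstCLM ℂ z.1)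

theorem tfShift_apply (z : ℝ × ℝ) (f : 𝓢(ℝ, ℂ)) (t : ℝ) :
    tfShift z f t = phase (-(z.2 * t)) * f (t - z.1) := by
  have h : Function.HasTemperateGrowth fun t : ℝ => phase (-(z.2 * t)) :=
    hasTemperateGrowth_phase (by fun_prop)
  rw [tfShift, smulLeftCLM_apply_apply h]
  rfl

theorem stft_eq_integral_phase (g f : ℝ → ℂ) (z : ℝ × ℝ) :
    stft g f z = ∫ t, f t * conj (g (t - z.1)) * phase (z.2 * t) := by
  refine integral_congr_ae (Filter.Eventually.of_forall fun t => ?_)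
  change _ * _ * fourierKernel t z.2 = _
  rw [fourierKernel_eq_phase, mul_comm t]

theorem stft_congr_ae {g g' f f' : ℝ → ℂ} (hg : g =ᵐ[volume] g') (hf : f =ᵐ[volume] f') :
    stft g f = stft g' f' := by
  funext z
  refine integral_congr_ae ?_
  filter_upwards [hf, (measurePreserving_sub_right volume z.1).quasiMeasurePreserving.ae_eq_comp hg]
    with t h1 h2
  simp only [Function.comp] at h2
  rw [h1, h2]

theorem inner_tfShift (g : 𝓢(ℝ, ℂ)) (f : Lp ℂ 2 (volume : Measure ℝ)) (z : ℝ × ℝ) :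
    inner ℂ ((tfShift z g).toLp 2 volume) f = stft g f z := by
  rw [L2.inner_def, stft_eq_integral_phase]
  refine integral_congr_ae ?_
  filter_upwards [(tfShift z g).coeFn_toLp 2 volume] with t ht
  simp only [RCLike.inner_apply, ht, tfShift_apply, map_mul, conj_phase, neg_neg]
  ring

theorem norm_toLp_sq (f : 𝓢(ℝ, ℂ)) : ‖f.toLp 2 volume‖ ^ 2 = ∫ t, ‖f t‖ ^ 2 := by
  rw [← inner_self_eq_norm_sq (𝕜 := ℂ), inner_toL2_toL2_eq f f volume]
  simp_rw [inner_self_eq_norm_sq_to_K]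
  norm_cast

theorem denseRange_toLp : DenseRange fun h : 𝓢(ℝ, ℂ) => h.toLp 2 (volume : Measure ℝ) :=
  denseRange_toLpCLM (E := ℝ) (F := ℂ) (p := 2) (μ := volume) (by simp)

theorem norm_tfShift (g : 𝓢(ℝ, ℂ)) (z : ℝ × ℝ) :
    ‖(tfShift z g).toLp 2 volume‖ = ‖g.toLp 2 volume‖ := by
  refine (sq_eq_sq₀ (norm_nonneg _) (norm_nonneg _)).1 ?_
  rw [norm_toLp_sq, norm_toLp_sq]
  simp_rw [tfShift_apply, norm_mul, norm_phase, one_mul]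
  exact integral_sub_right_eq_self (fun t => ‖g t‖ ^ 2) z.1

/-! ### Orthogonality relations -/

theorem integrable_mul_conj_sub {f φ : ℝ → ℂ} (hf : MemLp f 2 volume) (hφ : MemLp φ 2 volume)
    (x : ℝ) : Integrable fun t => f t * conj (φ (t - x)) :=
  hf.integrable_mul ((hφ.comp_measurePreserving (measurePreserving_sub_right volume x)).star)

theorem aestronglyMeasurable_stft {f φ : ℝ → ℂ} (hf : AEStronglyMeasurable f volume)
    (hφ : AEStronglyMeasurable φ volume) : AEStronglyMeasurable (stft φ f) volume := by
  have h1 : AEStronglyMeasurable (fun q : (ℝ × ℝ) × ℝ =>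
      f q.2 * conj (φ (q.2 - q.1.1)) * phase (q.1.2 * q.2)) (volume.prod volume) := by
    refine (AEStronglyMeasurable.mul hf.comp_snd ?_).mul ?_
    · have hq : Measure.QuasiMeasurePreserving (fun q : (ℝ × ℝ) × ℝ => q.2 - q.1.1)
          (volume.prod volume) volume :=
        MeasureTheory.QuasiMeasurePreserving.prod_of_right (by fun_prop)
          (Filter.Eventually.of_forall fun z =>
            (measurePreserving_sub_right volume z.1).quasiMeasurePreserving)
      exact Complex.continuous_conj.comp_aestronglyMeasurable (hφ.comp_quasiMeasurePreserving hq)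
    · exact (continuous_phase.comp (by fun_prop)).aestronglyMeasurable
  have h2 := h1.integral_prod_right'
  rw [show stft φ f = fun z => ∫ t, f t * conj (φ (t - z.1)) * phase (z.2 * t) from
    funext (stft_eq_integral_phase φ f)]
  exact h2

theorem exists_bound_stft {f φ : ℝ → ℂ} (hf : MemLp f 2 volume) (hφ : MemLp φ 2 volume) :
    ∃ B : ℝ, ∀ z, ‖stft φ f z‖ ≤ B := by
  have i1 := hf.integrable_norm_pow (by simp)
  have i2 := hφ.integrable_norm_pow (by simp)
  refine ⟨(∫ t, ‖f t‖ ^ 2) + ∫ t, ‖φ t‖ ^ 2, fun z => ?_⟩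
  rw [← integral_sub_right_eq_self (fun t => ‖φ t‖ ^ 2) z.1,
    ← integral_add i1 (i2.comp_sub_right z.1), stft_eq_integral_phase]
  refine norm_integral_le_of_norm_le (i1.add (i2.comp_sub_right z.1))
    (Filter.Eventually.of_forall fun t => ?_)
  simp only [norm_mul, norm_phase, mul_one, RCLike.norm_conj]
  change _ ≤ ‖f t‖ ^ 2 + ‖φ (t - z.1)‖ ^ 2
  nlinarith [sq_nonneg (‖f t‖ - ‖φ (t - z.1)‖), sq_nonneg (‖f t‖), sq_nonneg (‖φ (t - z.1)‖)]

/-- For f and φ merely in L² the first factor is bounded; the second is a Schwartz function and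
supplies integrability. This is why two of the four entries of the orthogonality relation below are
Schwartz. -/
theorem integrable_stft_mul_conj {f φ : ℝ → ℂ} (hf : MemLp f 2 volume) (hφ : MemLp φ 2 volume)
    (γ h : 𝓢(ℝ, ℂ)) : Integrable fun z => stft φ f z * conj (stft γ h z) := by
  obtain ⟨B, hB⟩ := exists_bound_stft hf hφ
  exact ((conjSchwartz (stftSchwartz γ h)).integrable).bdd_mul
    (aestronglyMeasurable_stft hf.1 hφ.1) (Filter.Eventually.of_forall hB)

/-- The multiplication formula ∫ F̂G = ∫ FĜ with G the inverse transform of u. It serves as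
Parseval's identity for F that is only integrable. -/
theorem integral_fourier_mul_fourierInv {F : ℝ → ℂ} (hF : Integrable F) (u : 𝓢(ℝ, ℂ)) :
    ∫ ξ, 𝓕 F ξ * (𝓕⁻ u : 𝓢(ℝ, ℂ)) ξ = ∫ t, F t * u t := by
  have h := VectorFourier.integral_bilin_fourierIntegral_eq_flip (ContinuousLinearMap.mul ℂ ℂ)
    (L := innerₗ ℝ) (μ := volume) (ν := volume) continuous_fourierChar continuous_inner hF
    (𝓕⁻ u : 𝓢(ℝ, ℂ)).integrable
  have h2 : ∀ x, 𝓕 (⇑(𝓕⁻ u : 𝓢(ℝ, ℂ))) x = u x := fun x => by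
    rw [← SchwartzMap.fourier_coe, FourierTransform.fourier_fourierInv_eq]
  have h3 : ∀ x, VectorFourier.fourierIntegral Real.fourierChar volume (innerₗ ℝ).flip
      (⇑(𝓕⁻ u : 𝓢(ℝ, ℂ))) x = u x := fun x => by
    rw [← h2 x, flip_innerₗ]; rfl
  simp only [h3] at h
  exact h

/-- For fixed x, Parseval in ξ turns the inner integral into ∫ f(t) conj(h(t)) γ(t-x) conj(φ(t-x))
dt. As a function of x this is a convolution, and the integral of a convolution is the product of
the integrals. -/
theorem integral_stft_mul_conj {f φ : ℝ → ℂ} (hf : MemLp f 2 volume) (hφ : MemLp φ 2 volume)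
    (γ h : 𝓢(ℝ, ℂ)) : ∫ z, stft φ f z * conj (stft γ h z) =
      (∫ t, f t * conj (h t)) * ∫ t, γ t * conj (φ t) := by
  rw [Measure.volume_eq_prod, integral_prod _ (integrable_stft_mul_conj hf hφ γ h)]
  set A : ℝ → ℂ := fun t => f t * conj (h t) with hA
  -- The reflection puts the inner integral into convolution form ∫ A(t) B(x-t) dt.
  set B : ℝ → ℂ := fun t => γ (-t) * conj (φ (-t)) with hB
  have hAi : Integrable A := by
    simpa using integrable_mul_conj_sub hf (h.memLp 2 volume) 0
  have hBi0 : Integrable fun t => γ t * conj (φ t) := by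
    simpa using integrable_mul_conj_sub (γ.memLp 2 volume) hφ 0
  have hBi : Integrable B := hBi0.comp_neg
  have hinner : ∀ x, ∫ ξ, stft φ f (x, ξ) * conj (stft γ h (x, ξ)) =
      ∫ t, A t * B (x - t) := by
    intro x
    set u : 𝓢(ℝ, ℂ) := smulLeftCLM ℂ (conjSchwartz h) (γ.compSubConstCLM ℂ x)
    have hu : ∀ t, u t = conj (h t) * γ (t - x) := fun t => by
      rw [smulLeftCLM_apply_apply (conjSchwartz h).hasTemperateGrowth]; rfl
    have e1 : ∀ ξ, stft φ f (x, ξ) = 𝓕 (fun t => f t * conj (φ (t - x))) ξ := fun ξ => by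
      rw [fourier_eq_integral_kernel]; rfl
    have e2 : ∀ ξ, conj (stft γ h (x, ξ)) = (𝓕⁻ u : 𝓢(ℝ, ℂ)) ξ := fun ξ => by
      rw [SchwartzMap.fourierInv_coe, Real.fourierInv_eq_fourier_neg, fourier_eq_integral_kernel,
        stft_eq_integral_phase, ← integral_conj]
      refine integral_congr_ae (Filter.Eventually.of_forall fun t => ?_)
      simp only [hu, map_mul, conj_phase, Complex.conj_conj, fourierKernel_eq_phase]
      ring_nf
    simp only [e1, e2]
    rw [integral_fourier_mul_fourierInv (integrable_mul_conj_sub hf hφ x) u]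
    refine integral_congr_ae (Filter.Eventually.of_forall fun t => ?_)
    simp only [hA, hB, hu, neg_sub]
    ring
  simp only [hinner]
  have key := integral_convolution (μ := (volume : Measure ℝ)) (ν := volume)
    (ContinuousLinearMap.mul ℂ ℂ) hAi hBi
  have hB' : ∫ t, B t = ∫ t, γ t * conj (φ t) :=
    integral_neg_eq_self (fun t => γ t * conj (φ t)) volume
  rw [← hB']
  exact key

theorem integral_stft_mul_conj_toLp (g h : 𝓢(ℝ, ℂ)) (F : Lp ℂ 2 (volume : Measure ℝ)) :
    ∫ z, stft g F z * conj (stft g (h.toLp 2 volume) z) =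
      inner ℂ (h.toLp 2 volume) F * inner ℂ (g.toLp 2 volume) (g.toLp 2 volume) := by
  have e : stft g (h.toLp 2 volume) = stft g h :=
    stft_congr_ae Filter.EventuallyEq.rfl (h.coeFn_toLp 2 volume)
  rw [e, integral_stft_mul_conj (Lp.memLp F) (g.memLp 2 volume), L2.inner_def,
    inner_toL2_toL2_eq g g volume]
  congr 1
  refine integral_congr_ae ?_
  filter_upwards [h.coeFn_toLp 2 volume] with t ht
  simp [ht, RCLike.inner_apply]

/-- The reproducing formula for the short-time Fourier transform, in weak form. -/
theorem integral_stft_mul_conj_of_integrable (g : 𝓢(ℝ, ℂ)) {F : Lp ℂ 2 (volume : Measure ℝ)}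
    (hF : Integrable (stft g F)) (Y : Lp ℂ 2 (volume : Measure ℝ)) :
    ∫ z, stft g F z * conj (stft g Y z) =
      inner ℂ Y F * inner ℂ (g.toLp 2 volume) (g.toLp 2 volume) := by
  -- Both sides are continuous in Y and agree for Schwartz Y. On the left, |V_g Y| ≤ ‖g‖‖Y‖ gives
  -- domination by a multiple of the integrable |V_g F|.
  refine denseRange_toLp.induction_on (p := fun Y => ∫ z, stft g F z * conj (stft g Y z) =
      inner ℂ Y F * inner ℂ (g.toLp 2 volume) (g.toLp 2 volume)) Y (isClosed_eq ?_ (by fun_prop))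
    fun h => integral_stft_mul_conj_toLp g h F
  refine continuous_iff_continuousAt.2 fun Y₀ => ?_
  have hbd : ∀ (Y : Lp ℂ 2 (volume : Measure ℝ)) z,
      ‖stft g Y z‖ ≤ ‖g.toLp 2 volume‖ * ‖Y‖ := fun Y z => by
    rw [← inner_tfShift, ← norm_tfShift g z]; exact norm_inner_le_norm _ _
  refine continuousAt_of_dominated (bound := fun z => ‖stft g F z‖ *
    (‖g.toLp 2 volume‖ * (‖Y₀‖ + 1))) (Filter.Eventually.of_forall fun Y => ?_) ?_
    (hF.norm.mul_const _) (Filter.Eventually.of_forall fun z => ?_)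
  · exact hF.1.mul (Complex.continuous_conj.comp_aestronglyMeasurable
      (aestronglyMeasurable_stft (Lp.memLp Y).1 (g.memLp 2 volume).1))
  · have : ∀ᶠ Y in nhds Y₀, ‖Y‖ < ‖Y₀‖ + 1 :=
      continuous_norm.continuousAt.eventually (gt_mem_nhds (by linarith))
    filter_upwards [this] with Y hY
    refine Filter.Eventually.of_forall fun z => ?_
    rw [norm_mul, RCLike.norm_conj]
    gcongr
    exact (hbd Y z).trans (by gcongr)
  · simp only [← inner_tfShift]
    fun_prop

@[fun_prop]
theorem hasTemperateGrowth_fst_comp {D E F : Type*} [NormedAddCommGroup D] [NormedSpace ℝ D]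
    [NormedAddCommGroup E] [NormedSpace ℝ E] [NormedAddCommGroup F] [NormedSpace ℝ F]
    {f : D → E × F} (hf : Function.HasTemperateGrowth f) :
    Function.HasTemperateGrowth fun x => (f x).1 :=
  (ContinuousLinearMap.fst ℝ E F).hasTemperateGrowth.comp hf

@[fun_prop]
theorem hasTemperateGrowth_snd_comp {D E F : Type*} [NormedAddCommGroup D] [NormedSpace ℝ D]
    [NormedAddCommGroup E] [NormedSpace ℝ E] [NormedAddCommGroup F] [NormedSpace ℝ F]
    {f : D → E × F} (hf : Function.HasTemperateGrowth f) :
    Function.HasTemperateGrowth fun x => (f x).2 :=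
  (ContinuousLinearMap.snd ℝ E F).hasTemperateGrowth.comp hf

/-! ### Gaussian windows -/

/-- The Gaussian `e^{-πt²}` on the line. -/
def gaussian1 : 𝓢(ℝ, ℂ) := slice gaussian2 0

theorem gaussian1_apply (t : ℝ) : gaussian1 t = (Real.exp (-π * t ^ 2) : ℂ) := by
  rw [gaussian1, slice_apply, gaussian2_apply]; simp

theorem integral_gaussian_mul_phase {b : ℝ} (hb : 0 < b) (ξ : ℝ) :
    ∫ t : ℝ, (Real.exp (-π * b * t ^ 2) : ℂ) * phase (t * ξ) =
      1 / (b : ℂ) ^ (1 / 2 : ℂ) * (Real.exp (-π / b * ξ ^ 2) : ℂ) := by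
  have h := congrFun (fourier_gaussian_pi (b := (b : ℂ)) (by simpa using hb)) ξ
  rw [fourier_eq_integral_kernel] at h
  simp only [fourierKernel_eq_phase] at h
  push_cast
  exact h

/-- The Gaussian is its own Fourier transform; read as an expansion of Φ into characters, this is
the tool for changing the window. -/
theorem integral_gaussian2_mul_phase (v : ℝ × ℝ) :
    ∫ η : ℝ × ℝ, gaussian2 η * phase (η.1 * v.1 + η.2 * v.2) = gaussian2 v := by
  have h1 : ∀ ξ : ℝ, ∫ t : ℝ, (Real.exp (-π * 1 * t ^ 2) : ℂ) * phase (t * ξ) =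
      (Real.exp (-π * ξ ^ 2) : ℂ) := fun ξ => by
    rw [integral_gaussian_mul_phase one_pos]; simp
  have h2 : ∀ η : ℝ × ℝ, gaussian2 η * phase (η.1 * v.1 + η.2 * v.2) =
      ((Real.exp (-π * 1 * η.1 ^ 2) : ℂ) * phase (η.1 * v.1)) *
        ((Real.exp (-π * 1 * η.2 ^ 2) : ℂ) * phase (η.2 * v.2)) := fun η => by
    rw [gaussian2_apply, phase_add, mul_add, Complex.ofReal_exp, Complex.ofReal_exp,
      Complex.ofReal_exp, Complex.ofReal_add, Complex.exp_add]
    simp only [mul_one]; ring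
  simp_rw [h2]
  rw [Measure.volume_eq_prod, integral_prod_mul (μ := volume) (ν := volume)
    (fun t : ℝ => (Real.exp (-π * 1 * t ^ 2) : ℂ) * phase (t * v.1))
    (fun t : ℝ => (Real.exp (-π * 1 * t ^ 2) : ℂ) * phase (t * v.2)), h1, h1, gaussian2_apply,
    mul_add, ← Complex.ofReal_mul, ← Real.exp_add]

theorem conjCharacter_eq_phase (ζ u : ℝ × ℝ) :
    conjCharacter ζ u = phase (ζ.1 * u.1 + ζ.2 * u.2) := rfl

theorem conjShiftedGaussian_eq (z ζ u : ℝ × ℝ) :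
    conjShiftedGaussian z ζ u = phase (ζ.1 * u.1 + ζ.2 * u.2) * gaussian2 (u - z) := by
  rw [conjShiftedGaussian, smulLeftCLM_apply_apply (hasTemperateGrowth_conjCharacter ζ)]
  rfl

/-- The Gaussian `e^{-2π(x² + ξ²)}` on the plane. -/
def narrowGaussian : 𝓢(ℝ × ℝ, ℂ) := smulLeftCLM ℂ gaussian2 gaussian2

theorem narrowGaussian_apply (u : ℝ × ℝ) : narrowGaussian u = gaussian2 u * gaussian2 u := by
  rw [narrowGaussian, smulLeftCLM_apply_apply gaussian2.hasTemperateGrowth, smul_eq_mul]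

/-- The complex conjugate of `M_ζ T_z` applied to the narrow Gaussian. -/
def conjShiftedNarrow (z ζ : ℝ × ℝ) : 𝓢(ℝ × ℝ, ℂ) :=
  smulLeftCLM ℂ (conjCharacter ζ) (narrowGaussian.compSubConstCLM ℂ z)

theorem conjShiftedNarrow_apply (z ζ u : ℝ × ℝ) :
    conjShiftedNarrow z ζ u =
      phase (ζ.1 * u.1 + ζ.2 * u.2) * (gaussian2 (u - z) * gaussian2 (u - z)) := by
  rw [conjShiftedNarrow, smulLeftCLM_apply_apply (hasTemperateGrowth_conjCharacter ζ),
    compSubConstCLM_apply, narrowGaussian_apply, conjCharacter_eq_phase, smul_eq_mul]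

/-- The map `(x, p) ↦ (x, p - L x)`. -/
def shearBy {X E : Type*} [NormedAddCommGroup X] [NormedSpace ℝ X] [NormedAddCommGroup E]
    [NormedSpace ℝ E] (L : X →L[ℝ] E) : (X × E) ≃L[ℝ] (X × E) :=
  ContinuousLinearEquiv.equivOfInverse
    ((ContinuousLinearMap.fst ℝ X E).prod
      (ContinuousLinearMap.snd ℝ X E - L ∘L ContinuousLinearMap.fst ℝ X E))
    ((ContinuousLinearMap.fst ℝ X E).prod
      (ContinuousLinearMap.snd ℝ X E + L ∘L ContinuousLinearMap.fst ℝ X E))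
    (fun p => by ext <;> simp) (fun p => by ext <;> simp)

theorem gaussian2_ne_zero (u : ℝ × ℝ) : gaussian2 u ≠ 0 := by
  rw [gaussian2_apply]; exact_mod_cast (Real.exp_pos _).ne'

/-- Multiplied by Φ(z), the shifted Gaussians become the slices of one Schwartz function of (z, u),
and slices depend continuously on z. Since Φ never vanishes, the factor can be divided out again. -/
theorem continuous_symbolSTFT_left (σ : 𝓢'(ℝ × ℝ, ℂ)) (ζ : ℝ × ℝ) :
    Continuous fun z => symbolSTFT σ z ζ := by
  set H : 𝓢((ℝ × ℝ) × (ℝ × ℝ), ℂ) := smulLeftCLM ℂ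
    (fun q : (ℝ × ℝ) × (ℝ × ℝ) => phase (ζ.1 * q.2.1 + ζ.2 * q.2.2))
    (compCLMOfContinuousLinearEquiv ℂ
      (shearBy (ContinuousLinearMap.id ℝ (ℝ × ℝ))) (tensor gaussian2 gaussian2)) with hH
  have hg : Function.HasTemperateGrowth
      fun q : (ℝ × ℝ) × (ℝ × ℝ) => phase (ζ.1 * q.2.1 + ζ.2 * q.2.2) :=
    hasTemperateGrowth_phase (by fun_prop)
  have hs : ∀ z, slice H z = gaussian2 z • conjShiftedGaussian z ζ := fun z => by
    ext u
    rw [slice_apply, hH, smulLeftCLM_apply_apply hg, smul_apply, conjShiftedGaussian_eq]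
    change phase _ * (gaussian2 z * gaussian2 (u - z)) = gaussian2 z * _
    ring
  have h1 : (fun z => symbolSTFT σ z ζ) = fun z => σ (slice H z) / gaussian2 z := by
    funext z
    rw [hs, map_smul, smul_eq_mul, mul_div_cancel_left₀ _ (gaussian2_ne_zero z), symbolSTFT]
  rw [h1]
  exact (σ.continuous.comp (continuous_slice H)).div gaussian2.continuous gaussian2_ne_zero

/-- Continuity in z turns the essential supremum over z into a bound at every z. In ζ an almost
everywhere bound suffices, since ζ will be integrated out. -/
theorem MemModulation.exists_ae_bound {s : ℝ} {σ : 𝓢'(ℝ × ℝ, ℂ)} (h : MemModulation s σ) :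
    ∃ K : ℝ, 0 ≤ K ∧ ∀ᵐ ζ, ∀ z, ‖symbolSTFT σ z ζ‖ ≤ K * weight s ζ := by
  refine ⟨(modulationNorm s σ).toReal, ENNReal.toReal_nonneg, ?_⟩
  filter_upwards [ae_le_essSup (f := fun ζ : ℝ × ℝ => essSup (fun z : ℝ × ℝ =>
    ‖symbolSTFT σ z ζ‖ₑ * ENNReal.ofReal (japanese ζ ^ s)) volume) (μ := volume)] with ζ hζ
  have hj : 0 < japanese ζ ^ s := Real.rpow_pos_of_pos (japanese_pos ζ) _
  have hcl : IsClosed {z | ‖symbolSTFT σ z ζ‖ ≤ (modulationNorm s σ).toReal * weight s ζ} :=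
    isClosed_le (continuous_symbolSTFT_left σ ζ).norm continuous_const
  have hae : ∀ᵐ z, z ∈ {z | ‖symbolSTFT σ z ζ‖ ≤ (modulationNorm s σ).toReal * weight s ζ} := by
    filter_upwards [ae_le_essSup (f := fun z : ℝ × ℝ =>
      ‖symbolSTFT σ z ζ‖ₑ * ENNReal.ofReal (japanese ζ ^ s)) (μ := volume)] with z hz
    have h1 := ENNReal.toReal_mono h.ne (hz.trans hζ)
    rw [ENNReal.toReal_mul, toReal_enorm, ENNReal.toReal_ofReal hj.le] at h1
    change ‖symbolSTFT σ z ζ‖ ≤ _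
    rw [weight, Real.rpow_neg (japanese_pos _).le, ← div_eq_mul_inv,
      le_div_iff₀ hj]
    exact h1
  have hd := Measure.dense_of_ae hae
  intro z
  have : z ∈ closure {z | ‖symbolSTFT σ z ζ‖ ≤ (modulationNorm s σ).toReal * weight s ζ} := hd z
  rwa [hcl.closure_eq] at this

/-- Change of window: the bound for the short-time Fourier transform of a symbol with respect to
the standard Gaussian implies the bound with respect to the narrow Gaussian. -/
theorem MemModulation.exists_bound_narrow {s : ℝ} (hs : 2 < s) {σ : 𝓢'(ℝ × ℝ, ℂ)}
    (h : MemModulation s σ) :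
    ∃ C : ℝ, 0 ≤ C ∧ ∀ z ζ, ‖σ (conjShiftedNarrow z ζ)‖ ≤ C * weight s ζ := by
  obtain ⟨K, hK0, hK⟩ := h.exists_ae_bound
  obtain ⟨A, hA⟩ := exists_bound_weight_of_schwartz s gaussian2
  have hA0 : 0 ≤ A := nonneg_of_mul_nonneg_left ((norm_nonneg _).trans (hA 0)) (weight_pos s 0)
  obtain ⟨B, hB0, hB⟩ := exists_integral_weight_mul_weight_le hs
  refine ⟨A * K * B, by positivity, fun z ζ => ?_⟩
  -- One of the two factors Φ(u-z) of the narrow window is expanded into characters of frequency η.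
  -- The slice of H at η is then Φ(η), up to a phase, times the shifted Gaussian of frequency ζ+η.
  set Q : (ℝ × ℝ) × (ℝ × ℝ) → ℝ := fun q =>
    (q.1.1 * (q.2.1 - z.1) + q.1.2 * (q.2.2 - z.2)) + (ζ.1 * q.2.1 + ζ.2 * q.2.2) with hQ
  have hg : Function.HasTemperateGrowth fun q => phase (Q q) :=
    hasTemperateGrowth_phase (by rw [hQ]; fun_prop)
  set H : 𝓢((ℝ × ℝ) × (ℝ × ℝ), ℂ) := smulLeftCLM ℂ (fun q => phase (Q q))
    (tensor gaussian2 (gaussian2.compSubConstCLM ℂ z)) with hH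
  have hHa : ∀ η u, H (η, u) = phase (Q (η, u)) * (gaussian2 η * gaussian2 (u - z)) :=
    fun η u => by rw [hH, smulLeftCLM_apply_apply hg]; rfl
  have hsl : ∀ η, slice H η = (phase (-(η.1 * z.1 + η.2 * z.2)) * gaussian2 η) •
      conjShiftedGaussian z (ζ + η) := fun η => by
    ext u
    rw [slice_apply, hHa, smul_apply, conjShiftedGaussian_eq, smul_eq_mul]
    have : Q (η, u) = -(η.1 * z.1 + η.2 * z.2) +
        ((ζ + η).1 * u.1 + (ζ + η).2 * u.2) := by simp [hQ]; ring
    rw [this, phase_add]; ring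
  have hint : ∀ u, conjShiftedNarrow z ζ u = ∫ η, H (η, u) := fun u => by
    have e : ∀ η, H (η, u) = (phase (ζ.1 * u.1 + ζ.2 * u.2) * gaussian2 (u - z)) *
        (gaussian2 η * phase (η.1 * (u - z).1 + η.2 * (u - z).2)) := fun η => by
      rw [hHa, hQ, phase_add]
      simp only [Prod.fst_sub, Prod.snd_sub]
      ring
    simp_rw [e]
    rw [integral_const_mul, integral_gaussian2_mul_phase, conjShiftedNarrow_apply]
    ring
  have hσ : ∫ η, σ (slice H η) = σ (conjShiftedNarrow z ζ) :=
    integral_slice (μ := volume) (show 𝓢(ℝ × ℝ, ℂ) →L[ℂ] ℂ from σ) H _ hint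
  rw [← hσ]
  have hKζ : ∀ᵐ η, ∀ z, ‖symbolSTFT σ z (ζ + η)‖ ≤ K * weight s (ζ + η) :=
    (measurePreserving_add_left volume ζ).quasiMeasurePreserving.ae hK
  -- Φ(η) and the bound on σ contribute ⟨η⟩^{-s} and ⟨ζ+η⟩^{-s}: the convolution estimate with
  -- centres 0 and -ζ.
  have hle : ∀ᵐ η, ‖σ (slice H η)‖ ≤ A * K * (weight s (η - 0) * weight s (η - -ζ)) := by
    filter_upwards [hKζ] with η hη
    rw [hsl, map_smul, norm_smul, norm_mul, norm_phase, one_mul, sub_zero, sub_neg_eq_add,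
      add_comm η ζ]
    calc ‖gaussian2 η‖ * ‖σ (conjShiftedGaussian z (ζ + η))‖
        ≤ (A * weight s η) * (K * weight s (ζ + η)) := by
          gcongr
          · exact mul_nonneg hA0 (weight_pos s η).le
          · exact hA η
          · exact hη z
      _ = _ := by ring
  refine (norm_integral_le_of_norm_le
    ((integrable_weight_mul_weight hs 0 (-ζ)).const_mul (A * K)) hle).trans ?_
  rw [integral_const_mul, mul_assoc _ B]
  have := hB 0 (-ζ)
  rw [zero_sub, neg_neg] at this
  gcongr

/-! ### The Wigner distribution of two shifted Gaussians -/

/-- After the shift of t by z.1 - w.1 the two exponents are squares of (x - m) ± t/2, m the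
midpoint, with sum 2(x - m)² + t²/2. The remaining t-integral is the Fourier transform of
e^{-πt²/2}, again a Gaussian, of the same width as the x-factor. -/
theorem wigner_tfShift_gaussian (z w : ℝ × ℝ) :
    wignerSchwartz (tfShift z gaussian1) (tfShift w gaussian1) =
      (1 / ((1 / 2 : ℝ) : ℂ) ^ (1 / 2 : ℂ) * phase (-((z.1 - w.1) * ((z.2 + w.2) / 2)))) •
        conjShiftedNarrow ((z.1 + w.1) / 2, (z.2 + w.2) / 2) (w.2 - z.2, z.1 - w.1) := by
  ext p
  rw [wignerSchwartz_apply, wigner, smul_apply, conjShiftedNarrow_apply, smul_eq_mul,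
    ← integral_add_right_eq_self _ (z.1 - w.1)]
  have e : ∀ t : ℝ, tfShift z gaussian1 (p.1 + (t + (z.1 - w.1)) / 2) *
      conj (tfShift w gaussian1 (p.1 - (t + (z.1 - w.1)) / 2)) *
      Complex.exp (-2 * π * Complex.I * ((t + (z.1 - w.1) : ℝ) : ℂ) * p.2) =
      (phase (-((z.1 - w.1) * ((z.2 + w.2) / 2))) *
        phase ((w.2 - z.2) * p.1 + (z.1 - w.1) * p.2) *
        (Real.exp (-2 * π * (p.1 - (z.1 + w.1) / 2) ^ 2) : ℂ)) *
      ((Real.exp (-π * (1 / 2) * t ^ 2) : ℂ) * phase (t * (p.2 - (z.2 + w.2) / 2))) := by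
    intro t
    have e0 : Complex.exp (-2 * π * Complex.I * ((t + (z.1 - w.1) : ℝ) : ℂ) * p.2) =
        phase ((t + (z.1 - w.1)) * p.2) := fourierKernel_eq_phase _ _
    rw [e0, tfShift_apply, tfShift_apply, gaussian1_apply, gaussian1_apply, map_mul, conj_phase,
      Complex.conj_ofReal]
    have e1 : phase (-(z.2 * (p.1 + (t + (z.1 - w.1)) / 2))) *
        phase (- -(w.2 * (p.1 - (t + (z.1 - w.1)) / 2))) * phase ((t + (z.1 - w.1)) * p.2) =
        phase (-((z.1 - w.1) * ((z.2 + w.2) / 2))) *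
        phase ((w.2 - z.2) * p.1 + (z.1 - w.1) * p.2) *
        phase (t * (p.2 - (z.2 + w.2) / 2)) := by
      simp only [← phase_add]; congr 1; ring
    have e2 : (Real.exp (-π * (p.1 + (t + (z.1 - w.1)) / 2 - z.1) ^ 2) : ℂ) *
        (Real.exp (-π * (p.1 - (t + (z.1 - w.1)) / 2 - w.1) ^ 2) : ℂ) =
        (Real.exp (-2 * π * (p.1 - (z.1 + w.1) / 2) ^ 2) : ℂ) *
        (Real.exp (-π * (1 / 2) * t ^ 2) : ℂ) := by
      rw [← Complex.ofReal_mul, ← Complex.ofReal_mul, ← Real.exp_add, ← Real.exp_add]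
      congr 2; ring
    linear_combination
      (Real.exp (-π * (p.1 + (t + (z.1 - w.1)) / 2 - z.1) ^ 2) : ℂ) *
        (Real.exp (-π * (p.1 - (t + (z.1 - w.1)) / 2 - w.1) ^ 2) : ℂ) * e1 +
      phase (-((z.1 - w.1) * ((z.2 + w.2) / 2))) *
        phase ((w.2 - z.2) * p.1 + (z.1 - w.1) * p.2) *
        phase (t * (p.2 - (z.2 + w.2) / 2)) * e2
  simp_rw [e]
  rw [integral_const_mul, integral_gaussian_mul_phase (by norm_num), gaussian2_apply]
  have e3 : (Real.exp (-2 * π * (p.1 - (z.1 + w.1) / 2) ^ 2) : ℂ) *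
      (Real.exp (-π / (1 / 2) * (p.2 - (z.2 + w.2) / 2) ^ 2) : ℂ) =
      (Real.exp (-π * ((p.1 - (z.1 + w.1) / 2) ^ 2 + (p.2 - (z.2 + w.2) / 2) ^ 2)) : ℂ) *
      (Real.exp (-π * ((p.1 - (z.1 + w.1) / 2) ^ 2 + (p.2 - (z.2 + w.2) / 2) ^ 2)) : ℂ) := by
    rw [← Complex.ofReal_mul, ← Complex.ofReal_mul, ← Real.exp_add, ← Real.exp_add]
    congr 2; ring
  simp only [Prod.fst_sub, Prod.snd_sub]
  rw [← e3]
  ring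

/-- The modulation (w.2 - z.2, z.1 - w.1) is z - w turned by a right angle, so it has the same
bracket. -/
theorem MemModulation.exists_bound_gabor_matrix {s : ℝ} (hs : 2 < s) {σ : 𝓢'(ℝ × ℝ, ℂ)}
    (h : MemModulation s σ) :
    ∃ C : ℝ, 0 ≤ C ∧ ∀ z w,
      ‖σ (wignerSchwartz (tfShift z gaussian1) (tfShift w gaussian1))‖ ≤ C * weight s (z - w) := by
  obtain ⟨C, hC0, hC⟩ := h.exists_bound_narrow hs
  refine ⟨‖(1 / ((1 / 2 : ℝ) : ℂ) ^ (1 / 2 : ℂ))‖ * C, by positivity, fun z w => ?_⟩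
  rw [wigner_tfShift_gaussian, map_smul, norm_smul, norm_mul, norm_phase, mul_one, mul_assoc]
  gcongr
  refine (hC _ _).trans_eq ?_
  congr 1
  simp only [weight, japanese, Prod.fst_sub, Prod.snd_sub]
  congr 2; ring

/-! ### Resolution of the Wigner distribution into time-frequency shifts -/

theorem integrable_slice_left {X E V : Type*} [NormedAddCommGroup X] [NormedSpace ℝ X]
    [NormedAddCommGroup E] [NormedSpace ℝ E] [NormedAddCommGroup V] [NormedSpace ℝ V]
    [MeasurableSpace X] [BorelSpace X] [SecondCountableTopology X] {μ : Measure X}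
    [μ.HasTemperateGrowth] (H : 𝓢(X × E, V)) (u : E) : Integrable (fun x => H (x, u)) μ := by
  obtain ⟨bound, hb, h⟩ := exists_integrable_bound_slice (μ := μ) H
  exact hb.mono' (H.continuous.comp (Continuous.prodMk_left u)).aestronglyMeasurable
    (Filter.Eventually.of_forall fun x => h x u)

theorem tensor_add_left (f f' g : 𝓢(ℝ, ℂ)) : tensor (f + f') g = tensor f g + tensor f' g := by
  ext p; simp [tensor_apply, add_mul]

theorem tensor_add_right (f g g' : 𝓢(ℝ, ℂ)) : tensor f (g + g') = tensor f g + tensor f g' := by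
  ext p; simp [tensor_apply, mul_add]

theorem tensor_smul_left (c : ℂ) (f g : 𝓢(ℝ, ℂ)) : tensor (c • f) g = c • tensor f g := by
  ext p; simp [tensor_apply, mul_assoc]

theorem tensor_smul_right (c : ℂ) (f g : 𝓢(ℝ, ℂ)) : tensor f (c • g) = c • tensor f g := by
  ext p; simp [tensor_apply, mul_left_comm]

theorem conjSchwartz_add (f g : 𝓢(ℝ, ℂ)) :
    conjSchwartz (f + g) = conjSchwartz f + conjSchwartz g := by
  ext p; simp [conjSchwartz_apply]

theorem conjSchwartz_smul (c : ℂ) (f : 𝓢(ℝ, ℂ)) :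
    conjSchwartz (c • f) = conj c • conjSchwartz f := by
  ext p; simp [conjSchwartz_apply]

theorem partialFourier_add (H K : 𝓢(ℝ × ℝ, ℂ)) :
    partialFourier (H + K) = partialFourier H + partialFourier K := by
  have hi : ∀ (H : 𝓢(ℝ × ℝ, ℂ)) (p : ℝ × ℝ),
      Integrable fun t => H (t, p.1) * fourierKernel t p.2 := fun H p =>
    (integrable_slice_left H p.1).mul_bdd (c := 1)
      (continuous_fourierKernel.comp (Continuous.prodMk_left p.2)).aestronglyMeasurable
      (Filter.Eventually.of_forall fun t => (norm_fourierKernel _ _).le)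
  ext p
  rw [add_apply, partialFourier_apply, partialFourier_apply, partialFourier_apply,
    ← integral_add (hi H p) (hi K p)]
  simp only [add_apply, add_mul]

theorem partialFourier_smul (c : ℂ) (H : 𝓢(ℝ × ℝ, ℂ)) :
    partialFourier (c • H) = c • partialFourier H := by
  ext p
  rw [smul_apply, partialFourier_apply, partialFourier_apply, smul_eq_mul, ← integral_const_mul]
  simp only [smul_apply, smul_eq_mul, mul_assoc]

theorem wignerSchwartz_add_left (f f' g : 𝓢(ℝ, ℂ)) :
    wignerSchwartz (f + f') g = wignerSchwartz f g + wignerSchwartz f' g := by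
  rw [wignerSchwartz, tensor_add_left, map_add, partialFourier_add]; rfl

theorem wignerSchwartz_add_right (f g g' : 𝓢(ℝ, ℂ)) :
    wignerSchwartz f (g + g') = wignerSchwartz f g + wignerSchwartz f g' := by
  rw [wignerSchwartz, conjSchwartz_add, tensor_add_right, map_add, partialFourier_add]; rfl

theorem wignerSchwartz_smul_left (c : ℂ) (f g : 𝓢(ℝ, ℂ)) :
    wignerSchwartz (c • f) g = c • wignerSchwartz f g := by
  rw [wignerSchwartz, tensor_smul_left, map_smul, partialFourier_smul]; rfl

theorem wignerSchwartz_smul_right (c : ℂ) (f g : 𝓢(ℝ, ℂ)) :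
    wignerSchwartz f (c • g) = conj c • wignerSchwartz f g := by
  rw [wignerSchwartz, conjSchwartz_smul, tensor_smul_right, map_smul, partialFourier_smul]; rfl

theorem wigner_eq_integral_phase (f g : ℝ → ℂ) (p : ℝ × ℝ) :
    wigner f g p = ∫ t, f (p.1 + t / 2) * conj (g (p.1 - t / 2)) * phase (t * p.2) := by
  refine integral_congr_ae (Filter.Eventually.of_forall fun t => ?_)
  change _ * _ * fourierKernel t p.2 = _
  rw [fourierKernel_eq_phase]

theorem conj_wigner (f g : ℝ → ℂ) (p : ℝ × ℝ) : conj (wigner f g p) = wigner g f p := by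
  rw [wigner_eq_integral_phase, wigner_eq_integral_phase, ← integral_conj,
    ← integral_neg_eq_self _ volume]
  refine integral_congr_ae (Filter.Eventually.of_forall fun t => ?_)
  simp only [map_mul, conj_phase, Complex.conj_conj, neg_div, sub_neg_eq_add, neg_mul, neg_neg,
    ← sub_eq_add_neg]
  ring

/-- The reflection `t ↦ 2 e^{4πi(t - x)ξ} h(2x - t)` of a Schwartz function at `(x, ξ)`. -/
def phaseReflect (p : ℝ × ℝ) (h : 𝓢(ℝ, ℂ)) : 𝓢(ℝ, ℂ) :=
  (2 : ℂ) • smulLeftCLM ℂ (fun t : ℝ => phase (-(2 * (t - p.1) * p.2)))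
    ((compCLMOfContinuousLinearEquiv ℂ (ContinuousLinearEquiv.neg ℝ : ℝ ≃L[ℝ] ℝ) h).compSubConstCLM
      ℂ (2 * p.1))

theorem phaseReflect_apply (p : ℝ × ℝ) (h : 𝓢(ℝ, ℂ)) (t : ℝ) :
    phaseReflect p h t = 2 * (phase (-(2 * (t - p.1) * p.2)) * h (2 * p.1 - t)) := by
  have hg : Function.HasTemperateGrowth fun t : ℝ => phase (-(2 * (t - p.1) * p.2)) :=
    hasTemperateGrowth_phase (by fun_prop)
  rw [phaseReflect, smul_apply, smulLeftCLM_apply_apply hg, ← neg_sub t]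
  rfl

/-- At a fixed point p, the Wigner distribution is an L² pairing of f with a Schwartz function, so
the orthogonality relations apply to it. -/
theorem wigner_eq_integral_phaseReflect (f : ℝ → ℂ) (h : 𝓢(ℝ, ℂ)) (p : ℝ × ℝ) :
    wigner f h p = ∫ t, f t * conj (phaseReflect p h t) := by
  rw [wigner_eq_integral_phase]
  have h1 := Measure.integral_comp_div (fun u => (f (p.1 + u) * conj (h (p.1 - u)) *
    phase (2 * u * p.2))) (2 : ℝ)
  have h2 : ∀ t : ℝ, 2 * (t / 2) = t := fun t => by ring
  simp only [h2] at h1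
  rw [h1, ← integral_sub_right_eq_self _ p.1, abs_of_pos two_pos, ← integral_smul]
  refine integral_congr_ae (Filter.Eventually.of_forall fun t => ?_)
  simp only [phaseReflect_apply, map_mul, conj_phase, neg_neg, Complex.real_smul, map_ofNat]
  rw [show p.1 - (t - p.1) = 2 * p.1 - t by ring, show p.1 + (t - p.1) = t by ring]
  push_cast
  ring

/-- The orthogonality relation with `phaseReflect p h` as second function: f is replaced by the
superposition of its time-frequency shifts of g. -/
theorem integral_stft_mul_wigner (f g h : 𝓢(ℝ, ℂ)) (p : ℝ × ℝ) :
    ∫ z, stft g f z * wigner (tfShift z g) h p =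
      wigner f h p * ∫ t, g t * conj (g t) := by
  rw [wigner_eq_integral_phaseReflect f h p,
    ← integral_stft_mul_conj (f.memLp 2 volume) (g.memLp 2 volume) g (phaseReflect p h)]
  refine integral_congr_ae (Filter.Eventually.of_forall fun z => ?_)
  simp only
  congr 1
  rw [wigner_eq_integral_phaseReflect, stft_eq_integral_phase, ← integral_conj]
  refine integral_congr_ae (Filter.Eventually.of_forall fun t => ?_)
  simp only [tfShift_apply, map_mul, Complex.conj_conj, conj_phase]
  ring

theorem integral_conj_stft_mul_wigner (f g h : 𝓢(ℝ, ℂ)) (p : ℝ × ℝ) :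
    ∫ w, conj (stft g h w) * wigner f (tfShift w g) p =
      wigner f h p * ∫ t, g t * conj (g t) := by
  have := congrArg conj (integral_stft_mul_wigner h g f p)
  rw [← integral_conj, map_mul, conj_wigner, ← integral_conj] at this
  simp only [map_mul, conj_wigner, Complex.conj_conj] at this
  rw [this]
  simp only [mul_comm]

/-- Passing σ through the double integral needs an integrand that is Schwartz jointly in z, w and p.
The STFT factors provide decay in z and w, the narrow Gaussian in p - (z+w)/2, and the phase has
temperate growth. -/
theorem exists_schwartz_gabor_wigner (f h : 𝓢(ℝ, ℂ)) :
    ∃ H : 𝓢(((ℝ × ℝ) × (ℝ × ℝ)) × (ℝ × ℝ), ℂ), ∀ z w p, H ((z, w), p) =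
      stft gaussian1 f z * conj (stft gaussian1 h w) *
        wigner (tfShift z gaussian1) (tfShift w gaussian1) p := by
  set Q : ((ℝ × ℝ) × (ℝ × ℝ)) × (ℝ × ℝ) → ℝ := fun q =>
    -((q.1.1.1 - q.1.2.1) * ((q.1.1.2 + q.1.2.2) / 2)) +
      ((q.1.2.2 - q.1.1.2) * q.2.1 + (q.1.1.1 - q.1.2.1) * q.2.2) with hQ
  have hg : Function.HasTemperateGrowth fun q => phase (Q q) :=
    hasTemperateGrowth_phase (by rw [hQ]; simp only [div_eq_mul_inv]; fun_prop)
  -- The midpoint map: `shearBy L` moves the narrow Gaussian to (z+w)/2.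
  set L : (ℝ × ℝ) × (ℝ × ℝ) →L[ℝ] ℝ × ℝ :=
    (1 / 2 : ℝ) • (ContinuousLinearMap.fst ℝ (ℝ × ℝ) (ℝ × ℝ) +
      ContinuousLinearMap.snd ℝ (ℝ × ℝ) (ℝ × ℝ)) with hL
  refine ⟨(1 / ((1 / 2 : ℝ) : ℂ) ^ (1 / 2 : ℂ)) • smulLeftCLM ℂ (fun q => phase (Q q))
    (compCLMOfContinuousLinearEquiv ℂ (shearBy L) (tensor
      (tensor (stftSchwartz gaussian1 f) (conjSchwartz (stftSchwartz gaussian1 h)))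
      narrowGaussian)), fun z w p => ?_⟩
  rw [smul_apply, smulLeftCLM_apply_apply hg, ← wignerSchwartz_apply, wigner_tfShift_gaussian,
    smul_apply, conjShiftedNarrow_apply, ← narrowGaussian_apply, smul_eq_mul, smul_eq_mul,
    smul_eq_mul]
  have e1 : L (z, w) = ((z.1 + w.1) / 2, (z.2 + w.2) / 2) := by
    rw [hL]; ext <;> simp <;> ring
  have e2 : compCLMOfContinuousLinearEquiv ℂ (shearBy L) (tensor
      (tensor (stftSchwartz gaussian1 f) (conjSchwartz (stftSchwartz gaussian1 h)))
      narrowGaussian) ((z, w), p) = stft gaussian1 f z * conj (stft gaussian1 h w) *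
        narrowGaussian (p - L (z, w)) := rfl
  rw [e2, e1, hQ, phase_add]
  ring

instance : (volume : Measure ((ℝ × ℝ) × (ℝ × ℝ))).HasTemperateGrowth := by
  have h1 : (volume : Measure (ℝ × ℝ)).IsAddHaarMeasure := inferInstance
  have h2 : (volume : Measure ((ℝ × ℝ) × (ℝ × ℝ))).IsAddHaarMeasure := by
    rw [Measure.volume_eq_prod]; exact Measure.prod.instIsAddHaarMeasure volume volume
  infer_instance

/-- Both entries of W(f, h) are resolved into shifts of φ; each resolution contributes one factor
‖φ‖². -/
theorem integral_gabor_matrix (σ : 𝓢'(ℝ × ℝ, ℂ)) (f h : 𝓢(ℝ, ℂ)) :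
    ∫ q : (ℝ × ℝ) × (ℝ × ℝ), stft gaussian1 f q.1 * conj (stft gaussian1 h q.2) *
        σ (wignerSchwartz (tfShift q.1 gaussian1) (tfShift q.2 gaussian1)) =
      (∫ t, gaussian1 t * conj (gaussian1 t)) ^ 2 * σ (wignerSchwartz f h) := by
  obtain ⟨H, hH⟩ := exists_schwartz_gabor_wigner f h
  set c := ∫ t, gaussian1 t * conj (gaussian1 t)
  have hint : ∀ p, (c ^ 2 • wignerSchwartz f h) p = ∫ q, H (q, p) := fun p => by
    have hi := integrable_slice_left (μ := volume) H p
    rw [Measure.volume_eq_prod] at hi ⊢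
    rw [integral_prod _ hi, smul_apply, smul_eq_mul, wignerSchwartz_apply]
    simp only [hH, mul_assoc]
    simp only [integral_const_mul, integral_conj_stft_mul_wigner]
    simp only [← mul_assoc]
    rw [integral_mul_const, integral_stft_mul_wigner]
    ring
  have hσ : ∫ q, σ (slice H q) = σ (c ^ 2 • wignerSchwartz f h) :=
    integral_slice (μ := volume) (show 𝓢(ℝ × ℝ, ℂ) →L[ℂ] ℂ from σ) H _ hint
  rw [map_smul, smul_eq_mul] at hσ
  rw [← hσ]
  refine integral_congr_ae (Filter.Eventually.of_forall fun q => ?_)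
  simp only
  rw [← smul_eq_mul, ← map_smul]
  congr 1
  ext p
  rw [smul_apply, slice_apply, smul_eq_mul, wignerSchwartz_apply, ← hH]

/-! ### Boundedness of the Weyl transform -/

theorem integral_mul_conj_self (f : 𝓢(ℝ, ℂ)) :
    ∫ t, f t * conj (f t) = ((‖f.toLp 2 volume‖ ^ 2 : ℝ) : ℂ) := by
  rw [norm_toLp_sq, ← integral_complex_ofReal]
  refine integral_congr_ae (Filter.Eventually.of_forall fun t => ?_)
  simp only [Complex.mul_conj']
  push_cast; rfl

theorem norm_gaussian1_pos : 0 < ‖gaussian1.toLp 2 (volume : Measure ℝ)‖ := by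
  refine norm_pos_iff.2 fun h => ?_
  have h0 : gaussian1.toLp 2 (volume : Measure ℝ) = (0 : 𝓢(ℝ, ℂ)).toLp 2 volume := by
    rw [h]; exact ((toLpCLM ℝ ℂ 2 (volume : Measure ℝ)).map_zero).symm
  have h1 := DFunLike.congr_fun (injective_toLp 2 volume h0) 0
  rw [gaussian1_apply] at h1
  simp at h1

theorem integral_norm_stft_sq (g f : 𝓢(ℝ, ℂ)) :
    ∫ z, ‖stft g f z‖ ^ 2 = ‖f.toLp 2 volume‖ ^ 2 * ‖g.toLp 2 volume‖ ^ 2 := by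
  have h := integral_stft_mul_conj (f.memLp 2 volume) (g.memLp 2 volume) g f
  rw [integral_mul_conj_self, integral_mul_conj_self] at h
  have e : ∀ z, stft g f z * conj (stft g f z) = ((‖stft g f z‖ ^ 2 : ℝ) : ℂ) := fun z => by
    rw [Complex.mul_conj']; push_cast; rfl
  simp only [e] at h
  rw [integral_complex_ofReal] at h
  exact_mod_cast h

theorem integrable_norm_stft_sq (g f : 𝓢(ℝ, ℂ)) : Integrable fun z => ‖stft g f z‖ ^ 2 :=
  ((stftSchwartz g f).memLp 2 volume).integrable_norm_pow (by simp)

theorem integrable_mul_weight_sub {s : ℝ} (hs : 2 < s) {u : ℝ × ℝ → ℝ} (hu : Integrable u) :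
    Integrable fun q : (ℝ × ℝ) × (ℝ × ℝ) => u q.2 * weight s (q.1 - q.2) :=
  hu.convolution_integrand (ContinuousLinearMap.mul ℝ ℝ) (integrable_weight hs)

theorem integral_mul_weight_sub {s : ℝ} (hs : 2 < s) {u : ℝ × ℝ → ℝ} (hu : Integrable u) :
    ∫ q : (ℝ × ℝ) × (ℝ × ℝ), u q.2 * weight s (q.1 - q.2) = (∫ z, u z) * ∫ z, weight s z := by
  have hi := integrable_mul_weight_sub hs hu
  rw [Measure.volume_eq_prod] at hi ⊢
  rw [integral_prod _ hi]
  exact integral_convolution (ContinuousLinearMap.mul ℝ ℝ) hu (integrable_weight hs)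

theorem integrable_mul_weight_sub' {s : ℝ} (hs : 2 < s) {u : ℝ × ℝ → ℝ} (hu : Integrable u) :
    Integrable fun q : (ℝ × ℝ) × (ℝ × ℝ) => u q.1 * weight s (q.1 - q.2) := by
  simp_rw [weight_sub_comm s (Prod.fst _)]
  exact (integrable_mul_weight_sub hs hu).swap

theorem integral_mul_weight_sub' {s : ℝ} (hs : 2 < s) {u : ℝ × ℝ → ℝ} (hu : Integrable u) :
    ∫ q : (ℝ × ℝ) × (ℝ × ℝ), u q.1 * weight s (q.1 - q.2) = (∫ z, u z) * ∫ z, weight s z := by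
  rw [← integral_mul_weight_sub hs hu]
  refine Eq.trans ?_ (integral_prod_swap (μ := volume) (ν := volume)
    (fun q : (ℝ × ℝ) × (ℝ × ℝ) => u q.2 * weight s (q.1 - q.2)))
  refine integral_congr_ae (Filter.Eventually.of_forall fun q => ?_)
  simp only [Prod.fst_swap, Prod.snd_swap, weight_sub_comm s q.1]

/-- Minimizing over r replaces the Cauchy–Schwarz inequality. The optimal r = b/a is perturbed by ε
because a or b may vanish. -/
theorem le_mul_of_forall_le_weighted {x K a b : ℝ} (hK : 0 ≤ K) (ha : 0 ≤ a) (hb : 0 ≤ b)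
    (h : ∀ r > 0, x ≤ K * ((r * a ^ 2 + b ^ 2 / r) / 2)) : x ≤ K * (a * b) := by
  have h1 : ∀ ε > 0, x ≤ K * ((a + ε) * (b + ε)) := fun ε hε => by
    have ha' : 0 < a + ε := by positivity
    have hb' : 0 < b + ε := by positivity
    refine (h ((b + ε) / (a + ε)) (by positivity)).trans ?_
    gcongr
    have e1 : (b + ε) / (a + ε) * a ^ 2 ≤ (b + ε) / (a + ε) * (a + ε) ^ 2 := by
      gcongr; linarith
    have e2 : b ^ 2 / ((b + ε) / (a + ε)) ≤ (b + ε) ^ 2 / ((b + ε) / (a + ε)) := by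
      gcongr; linarith
    have e3 : (b + ε) / (a + ε) * (a + ε) ^ 2 = (a + ε) * (b + ε) := by field_simp
    have e4 : (b + ε) ^ 2 / ((b + ε) / (a + ε)) = (a + ε) * (b + ε) := by field_simp
    linarith
  have h2 : Filter.Tendsto (fun ε : ℝ => K * ((a + ε) * (b + ε))) (nhdsWithin 0 (Set.Ioi 0))
      (nhds (K * ((a + 0) * (b + 0)))) :=
    ((by fun_prop : Continuous fun ε : ℝ => K * ((a + ε) * (b + ε))).tendsto 0).mono_left
      nhdsWithin_le_nhds
  rw [add_zero, add_zero] at h2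
  exact ge_of_tendsto h2 (Filter.eventually_of_mem self_mem_nhdsWithin h1)

/-- Schur's test: the product of the two STFTs is split by ab ≤ (ra² + b²/r)/2, and each half
integrates against ⟨z-w⟩^{-s} to an L² norm squared times ∫⟨·⟩^{-s}. -/
theorem MemModulation.exists_bound_wigner {s : ℝ} (hs : 2 < s) {σ : 𝓢'(ℝ × ℝ, ℂ)}
    (h : MemModulation s σ) : ∃ C : ℝ, 0 ≤ C ∧ ∀ f h : 𝓢(ℝ, ℂ),
      ‖σ (wignerSchwartz f h)‖ ≤ C * (‖f.toLp 2 volume‖ * ‖h.toLp 2 volume‖) := by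
  obtain ⟨C, hC0, hC⟩ := h.exists_bound_gabor_matrix hs
  set G := ‖gaussian1.toLp 2 (volume : Measure ℝ)‖ ^ 2 with hG
  have hG0 : 0 < G := pow_pos norm_gaussian1_pos 2
  have hI0 : 0 ≤ ∫ z, weight s z := integral_nonneg fun z => (weight_pos s z).le
  set I := ∫ z, weight s z with hI
  -- G² in the denominator comes from the double resolution, G in the numerator from ‖V_φ f‖² =
  -- G‖f‖², and I from integrating the weight.
  refine ⟨C * (G * I) / G ^ 2, by positivity, fun f h => ?_⟩
  have hkey : G ^ 2 * ‖σ (wignerSchwartz f h)‖ ≤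
      (C * (G * I)) * (‖f.toLp 2 volume‖ * ‖h.toLp 2 volume‖) := by
    refine le_mul_of_forall_le_weighted (by positivity) (norm_nonneg _) (norm_nonneg _)
      fun r hr => ?_
    have e := congrArg norm (integral_gabor_matrix σ f h)
    rw [integral_mul_conj_self, ← hG, norm_mul, norm_pow, Complex.norm_real, Real.norm_eq_abs,
      abs_of_pos hG0] at e
    rw [← e]
    have i1 := (integrable_mul_weight_sub' hs (integrable_norm_stft_sq gaussian1 f)).const_mul
      (C * (r / 2))
    have i2 := (integrable_mul_weight_sub hs (integrable_norm_stft_sq gaussian1 h)).const_mul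
      (C * (1 / (2 * r)))
    refine (norm_integral_le_of_norm_le (i1.add i2) (Filter.Eventually.of_forall
      fun q => ?_)).trans_eq ?_
    · rw [norm_mul, norm_mul, RCLike.norm_conj]
      set a := ‖stft gaussian1 f q.1‖
      set b := ‖stft gaussian1 h q.2‖
      have hab : a * b ≤ r / 2 * a ^ 2 + 1 / (2 * r) * b ^ 2 := by
        have : r / 2 * a ^ 2 + 1 / (2 * r) * b ^ 2 - a * b = (r * a - b) ^ 2 / (2 * r) := by
          field_simp; ring
        have h3 : 0 ≤ (r * a - b) ^ 2 / (2 * r) := by positivity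
        linarith
      have hw := weight_pos s (q.1 - q.2)
      calc a * b * ‖σ (wignerSchwartz (tfShift q.1 gaussian1) (tfShift q.2 gaussian1))‖
          ≤ (r / 2 * a ^ 2 + 1 / (2 * r) * b ^ 2) * (C * weight s (q.1 - q.2)) :=
            mul_le_mul hab (hC _ _) (norm_nonneg _) (by positivity)
        _ = _ := by simp only [Pi.add_apply]; ring
    · simp only [Pi.add_apply]
      rw [integral_add i1 i2, integral_const_mul, integral_const_mul,
        integral_mul_weight_sub' hs (integrable_norm_stft_sq gaussian1 f),
        integral_mul_weight_sub hs (integrable_norm_stft_sq gaussian1 h),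
        integral_norm_stft_sq, integral_norm_stft_sq, ← hG, ← hI]
      field_simp
  rw [div_mul_eq_mul_div, le_div_iff₀ (by positivity), mul_comm]
  exact hkey

/-- For fixed g the functional f ↦ σ(W(f, g)) is bounded on a dense subspace, so it is f ↦ ⟨f, Sg⟩
by Riesz. S is linear and bounded, and the Weyl operator is the adjoint of its extension. -/
theorem exists_isWeylOperator {σ : 𝓢'(ℝ × ℝ, ℂ)} {C : ℝ} (hC0 : 0 ≤ C)
    (hC : ∀ f h : 𝓢(ℝ, ℂ), ‖σ (wignerSchwartz f h)‖ ≤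
      C * (‖f.toLp 2 volume‖ * ‖h.toLp 2 volume‖)) :
    ∃ T : Lp ℂ 2 (volume : Measure ℝ) →L[ℂ] Lp ℂ 2 (volume : Measure ℝ), IsWeylOperator σ T := by
  set e : 𝓢(ℝ, ℂ) →ₗ[ℂ] Lp ℂ 2 (volume : Measure ℝ) :=
    (toLpCLM ℂ ℂ 2 (volume : Measure ℝ)).toLinearMap with he
  have hd : DenseRange e := denseRange_toLp
  have hea : ∀ f, e f = f.toLp 2 volume := fun f => rfl
  have h1 : ∀ g : 𝓢(ℝ, ℂ), ∃ v : Lp ℂ 2 (volume : Measure ℝ), ‖v‖ ≤ C * ‖e g‖ ∧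
      ∀ f : 𝓢(ℝ, ℂ), inner ℂ v (e f) = σ (wignerSchwartz f g) := fun g => by
    set φ : 𝓢(ℝ, ℂ) →ₗ[ℂ] ℂ :=
      { toFun f := σ (wignerSchwartz f g)
        map_add' f f' := by rw [wignerSchwartz_add_left, map_add]
        map_smul' c f := by rw [wignerSchwartz_smul_left, map_smul]; rfl } with hφ
    have hb : ∀ f, ‖φ f‖ ≤ C * ‖e g‖ * ‖e f‖ := fun f =>
      (hC f g).trans_eq (by rw [hea, hea]; ring)
    refine ⟨(InnerProductSpace.toDual ℂ _).symm (φ.extendOfNorm e), ?_, fun f => ?_⟩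
    · rw [LinearIsometryEquiv.norm_map]
      exact LinearMap.opNorm_extendOfNorm_le hd (by positivity) hb
    · rw [InnerProductSpace.toDual_symm_apply, LinearMap.extendOfNorm_eq hd ⟨_, hb⟩]; rfl
  choose S hS1 hS2 using h1
  -- A vector is determined by its pairings with Schwartz functions; this makes the chosen
  -- representatives S g linear in g.
  have hext : ∀ v w : Lp ℂ 2 (volume : Measure ℝ), (∀ f, inner ℂ v (e f) = inner ℂ w (e f)) →
      v = w := fun v w hvw => by
    refine ext_inner_right ℂ fun x => ?_
    have hv : Continuous fun x : Lp ℂ 2 (volume : Measure ℝ) => inner ℂ v x := by fun_prop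
    have hw : Continuous fun x : Lp ℂ 2 (volume : Measure ℝ) => inner ℂ w x := by fun_prop
    exact congrFun (DenseRange.equalizer hd hv hw (funext hvw)) x
  set Sl : 𝓢(ℝ, ℂ) →ₗ[ℂ] Lp ℂ 2 (volume : Measure ℝ) :=
    { toFun := S
      map_add' g g' := hext _ _ fun f => by
        rw [inner_add_left, hS2, hS2, hS2, wignerSchwartz_add_right, map_add]
      map_smul' c g := hext _ _ fun f => by
        rw [RingHom.id_apply, inner_smul_left, hS2, hS2, wignerSchwartz_smul_right, map_smul,
          smul_eq_mul] }
  refine ⟨ContinuousLinearMap.adjoint (Sl.extendOfNorm e), fun f g =>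
    ⟨wignerSchwartz f g, wignerSchwartz_apply f g, ?_⟩⟩
  rw [ContinuousLinearMap.adjoint_inner_right, ← hea g,
    LinearMap.extendOfNorm_eq hd ⟨C, hS1⟩]
  exact hS2 g f

theorem IsWeylOperator.inner_toLp {σ : 𝓢'(ℝ × ℝ, ℂ)}
    {T : Lp ℂ 2 (volume : Measure ℝ) →L[ℂ] Lp ℂ 2 (volume : Measure ℝ)}
    (hT : IsWeylOperator σ T) (f g : 𝓢(ℝ, ℂ)) :
    inner ℂ (g.toLp 2 volume) (T (f.toLp 2 volume)) = σ (wignerSchwartz f g) := by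
  obtain ⟨w, hw, h⟩ := hT f g
  rw [h]
  congr 1
  ext p
  rw [hw, wignerSchwartz_apply]

/-! ### Decay of short-time Fourier transforms -/

theorem stft_shift (g f : ℝ → ℂ) (w z : ℝ × ℝ) :
    stft g (fun t => phase (-(w.2 * t)) * f (t - w.1)) z =
      phase ((z.2 - w.2) * w.1) * stft g f (z - w) := by
  rw [stft_eq_integral_phase, stft_eq_integral_phase, ← integral_add_right_eq_self _ w.1,
    ← integral_const_mul]
  refine integral_congr_ae (Filter.Eventually.of_forall fun t => ?_)
  simp only [add_sub_cancel_right, Prod.fst_sub, Prod.snd_sub]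
  have e : phase (-(w.2 * (t + w.1))) * phase (z.2 * (t + w.1)) =
      phase ((z.2 - w.2) * w.1) * phase ((z.2 - w.2) * t) := by
    simp only [← phase_add]; congr 1; ring
  rw [show t + w.1 - z.1 = t - (z.1 - w.1) by ring]
  linear_combination (f t * conj (g (t - (z.1 - w.1)))) * e

theorem norm_stft_tfShift (g f : 𝓢(ℝ, ℂ)) (w z : ℝ × ℝ) :
    ‖stft g (tfShift w f) z‖ = ‖stft g f (z - w)‖ := by
  rw [show ⇑(tfShift w f) = fun t => phase (-(w.2 * t)) * f (t - w.1) from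
    funext (tfShift_apply w f), stft_shift, norm_mul, norm_phase, one_mul]

theorem integral_mul_conj_tfShift (g : 𝓢(ℝ, ℂ)) (f : ℝ → ℂ) (w : ℝ × ℝ) :
    ∫ t, f t * conj (tfShift w g t) = stft g f w := by
  rw [stft_eq_integral_phase]
  refine integral_congr_ae (Filter.Eventually.of_forall fun t => ?_)
  simp only [tfShift_apply, map_mul, conj_phase, neg_neg]
  ring

theorem ae_eq_zero_of_forall_integral_mul_conj {b : ℝ → ℂ} (hb : MemLp b 2 volume)
    (h : ∀ γ : 𝓢(ℝ, ℂ), ∫ t, γ t * conj (b t) = 0) : b =ᵐ[volume] 0 := by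
  have h0 : ∀ x, inner ℂ (hb.toLp b) x = 0 := by
    have h1 : (fun γ : 𝓢(ℝ, ℂ) => inner ℂ (hb.toLp b) (γ.toLp 2 volume)) = fun _ => 0 := by
      funext γ
      rw [← h γ, L2.inner_def]
      refine integral_congr_ae ?_
      filter_upwards [γ.coeFn_toLp 2 volume, hb.coeFn_toLp] with t h1 h2
      simp [h1, h2, RCLike.inner_apply]
    have hv : Continuous fun x : Lp ℂ 2 (volume : Measure ℝ) => inner ℂ (hb.toLp b) x := by
      fun_prop
    exact congrFun (DenseRange.equalizer denseRange_toLp hv continuous_const h1)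
  have h2 : hb.toLp b = 0 := inner_self_eq_zero.1 (h0 _)
  exact hb.coeFn_toLp.symm.trans ((Lp.eq_zero_iff_ae_eq_zero).1 h2)

/-- By orthogonality ⟨γ, b⟩ V_g b(w) = ∫ V_b b · conj(V_γ(π(w)g)), where |V_γ(π(w)g)(z)| = |V_γ
g(z-w)| has Schwartz decay. With N > s the convolution estimate gives decay ⟨w⟩^{-s}. -/
theorem MemAmalgam.exists_bound_stft {α : ℝ} (hα : 0 < α) {N : ℕ} {s : ℝ} (hs : 2 < s)
    (hN : s < N) {b : ℝ → ℂ} (hb : MemLp b 2 volume) (h : MemAmalgam α N (stft b b))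
    (g : 𝓢(ℝ, ℂ)) : ∃ A : ℝ, 0 ≤ A ∧ ∀ w, ‖stft g b w‖ ≤ A * weight s w := by
  -- The argument divides by ⟨γ, b⟩ for a Schwartz γ; if all these pairings vanish, b is zero almost
  -- everywhere.
  by_cases h0 : ∀ γ : 𝓢(ℝ, ℂ), ∫ t, γ t * conj (b t) = 0
  · refine ⟨0, le_rfl, fun w => ?_⟩
    rw [stft_congr_ae Filter.EventuallyEq.rfl (ae_eq_zero_of_forall_integral_mul_conj hb h0)]
    simp [stft]
  push Not at h0
  obtain ⟨γ, hγ⟩ := h0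
  obtain ⟨K, hK⟩ := h.exists_ae_bound hα
  obtain ⟨B, hB⟩ := exists_bound_weight_of_schwartz s (stftSchwartz γ g)
  obtain ⟨D, hD0, hD⟩ := exists_integral_weight_mul_weight_le hs
  have hB0 : 0 ≤ B := nonneg_of_mul_nonneg_left ((norm_nonneg _).trans (hB 0)) (weight_pos s 0)
  have hγ' : 0 < ‖∫ t, γ t * conj (b t)‖ := norm_pos_iff.2 hγ
  refine ⟨|K| * B * D / ‖∫ t, γ t * conj (b t)‖, by positivity, fun w => ?_⟩
  rw [div_mul_eq_mul_div, le_div_iff₀ hγ', ← norm_mul, ← integral_mul_conj_tfShift,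
    ← integral_stft_mul_conj hb hb γ (tfShift w g)]
  have hle : ∀ᵐ z, ‖stft b b z * conj (stft γ (tfShift w g) z)‖ ≤
      |K| * B * (weight s (z - 0) * weight s (z - w)) := by
    filter_upwards [hK] with z hz
    rw [norm_mul, RCLike.norm_conj, norm_stft_tfShift, sub_zero]
    have h1 : weight N z ≤ weight s z :=
      Real.rpow_le_rpow_of_exponent_le (one_le_japanese z) (by linarith)
    have h2 : ‖stft b b z‖ ≤ |K| * weight s z :=
      hz.trans (mul_le_mul (le_abs_self K) h1 (weight_pos _ z).le (abs_nonneg K))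
    calc _ ≤ (|K| * weight s z) * (B * weight s (z - w)) :=
          mul_le_mul h2 (hB (z - w)) (norm_nonneg _)
            (mul_nonneg (abs_nonneg K) (weight_pos s z).le)
      _ = _ := by ring
  refine (norm_integral_le_of_norm_le
    ((integrable_weight_mul_weight hs 0 w).const_mul (|K| * B)) hle).trans ?_
  rw [integral_const_mul, mul_assoc _ D]
  have := hD 0 w
  rw [zero_sub, weight_neg] at this
  gcongr

/-! ### Almost diagonalization -/

theorem norm_integral_mul_conj_le {s : ℝ} (hs : 2 < s) {D A B : ℝ}
    (hD : ∀ a b : ℝ × ℝ, ∫ z, weight s (z - a) * weight s (z - b) ≤ D * weight s (a - b))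
    (hA : 0 ≤ A) (hB : 0 ≤ B) {F G : ℝ × ℝ → ℂ} {a b : ℝ × ℝ}
    (hF : ∀ z, ‖F z‖ ≤ A * weight s (z - a)) (hG : ∀ z, ‖G z‖ ≤ B * weight s (z - b)) :
    ‖∫ z, F z * conj (G z)‖ ≤ A * B * D * weight s (a - b) := by
  refine (norm_integral_le_of_norm_le
    ((integrable_weight_mul_weight hs a b).const_mul (A * B))
    (Filter.Eventually.of_forall fun z => ?_)).trans ?_
  · rw [norm_mul, RCLike.norm_conj]
    calc _ ≤ (A * weight s (z - a)) * (B * weight s (z - b)) :=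
          mul_le_mul (hF z) (hG z) (norm_nonneg _) (mul_nonneg hA (weight_pos s _).le)
      _ = _ := by ring
  · rw [integral_const_mul, mul_assoc _ D]
    exact mul_le_mul_of_nonneg_left (hD a b) (mul_nonneg hA hB)

theorem integrable_stft_of_bound {s : ℝ} (hs : 2 < s) (g : 𝓢(ℝ, ℂ))
    {F : Lp ℂ 2 (volume : Measure ℝ)} {A : ℝ} {a : ℝ × ℝ}
    (hF : ∀ z, ‖stft g F z‖ ≤ A * weight s (z - a)) : Integrable (stft g F) :=
  (((integrable_weight hs).comp_sub_right a).const_mul A).mono'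
    (aestronglyMeasurable_stft (Lp.memLp F).1 (g.memLp 2 volume).1)
    (Filter.Eventually.of_forall hF)

/-- Off-diagonal decay of the Weyl transform on functions that are localized in phase space. -/
theorem IsWeylOperator.exists_bound_inner {s : ℝ} (hs : 2 < s) {σ : 𝓢'(ℝ × ℝ, ℂ)}
    (h : MemModulation s σ)
    {T : Lp ℂ 2 (volume : Measure ℝ) →L[ℂ] Lp ℂ 2 (volume : Measure ℝ)}
    (hT : IsWeylOperator σ T) :
    ∃ K : ℝ, 0 ≤ K ∧ ∀ (F G : Lp ℂ 2 (volume : Measure ℝ)) (A B : ℝ) (a b : ℝ × ℝ),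
      0 ≤ A → 0 ≤ B → (∀ z, ‖stft gaussian1 F z‖ ≤ A * weight s (z - a)) →
      (∀ z, ‖stft gaussian1 G z‖ ≤ B * weight s (z - b)) →
      ‖(inner ℂ G (T F) : ℂ)‖ ≤ K * (A * B) * weight s (a - b) := by
  obtain ⟨C, hC0, hC⟩ := h.exists_bound_gabor_matrix hs
  obtain ⟨D, hD0, hD⟩ := exists_integral_weight_mul_weight_le hs
  set c : ℂ := inner ℂ (gaussian1.toLp 2 (volume : Measure ℝ)) (gaussian1.toLp 2 volume) with hc
  have hc0 : 0 < ‖c‖ := norm_pos_iff.2 (inner_self_ne_zero.2 (norm_pos_iff.1 norm_gaussian1_pos))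
  refine ⟨C * D * D / ‖c‖ / ‖c‖, by positivity, fun F G A B a b hA hB hF hG => ?_⟩
  -- The adjoint image of G is again localized at b: expand G by the reproducing formula and
  -- convolve its decay with the Gabor matrix. A second convolution, with F, then finishes; each
  -- costs one factor D and one division by ‖c‖.
  have h1 : ∀ u, ‖stft gaussian1 (ContinuousLinearMap.adjoint T G) u‖ ≤
      B * C * D / ‖c‖ * weight s (u - b) := fun u => by
    rw [← inner_tfShift, ContinuousLinearMap.adjoint_inner_right, div_mul_eq_mul_div,
      le_div_iff₀ hc0, ← norm_mul, hc,
      ← integral_stft_mul_conj_of_integrable gaussian1 (integrable_stft_of_bound hs _ hG),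
      weight_sub_comm]
    refine norm_integral_mul_conj_le hs hD hB hC0 hG fun v => ?_
    rw [← inner_tfShift, hT.inner_toLp, weight_sub_comm]
    exact hC u v
  rw [← ContinuousLinearMap.adjoint_inner_left]
  have h2 := norm_integral_mul_conj_le hs hD hA (by positivity) hF h1
  rw [integral_stft_mul_conj_of_integrable gaussian1 (integrable_stft_of_bound hs _ hF),
    ← hc, norm_mul, ← le_div_iff₀ hc0] at h2
  refine h2.trans_eq ?_
  field_simp

/-- The modulated windows from which the local sine functions are built. -/
def localExp (α : ℝ) (b : ℝ → ℂ) (z : ℝ × ℝ) (t : ℝ) : ℂ :=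
  (Real.sqrt (2 / α) / (2 * Complex.I) * phase (z.2 * z.1)) *
    (phase (-(z.2 * t)) * b (t - z.1))

theorem memLp_localExp (α : ℝ) {b : ℝ → ℂ} (hb : MemLp b 2 volume) (z : ℝ × ℝ) :
    MemLp (localExp α b z) 2 volume := by
  have h1 : MemLp (fun t : ℝ => b (t - z.1)) 2 volume :=
    hb.comp_measurePreserving (measurePreserving_sub_right volume z.1)
  refine MemLp.const_mul ?_ _
  refine h1.of_le ((continuous_phase.comp (by fun_prop)).aestronglyMeasurable.mul h1.1)
    (Filter.Eventually.of_forall fun t => ?_)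
  rw [norm_mul, norm_phase, one_mul]

theorem norm_stft_localExp (α : ℝ) {b : ℝ → ℂ} (hb : MemLp b 2 volume) (g : ℝ → ℂ)
    (w z : ℝ × ℝ) : ‖stft g ((memLp_localExp α hb w).toLp _) z‖ =
      ‖(Real.sqrt (2 / α) / (2 * Complex.I) : ℂ)‖ * ‖stft g b (z - w)‖ := by
  rw [stft_congr_ae Filter.EventuallyEq.rfl (memLp_localExp α hb w).coeFn_toLp]
  have e : stft g (localExp α b w) z =
      (Real.sqrt (2 / α) / (2 * Complex.I) * phase (w.2 * w.1)) *
        stft g (fun t => phase (-(w.2 * t)) * b (t - w.1)) z := by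
    rw [stft, stft, ← integral_const_mul]
    refine integral_congr_ae (Filter.Eventually.of_forall fun t => ?_)
    simp only [localExp, mul_assoc]
  rw [e, stft_shift, norm_mul, norm_mul, norm_mul, norm_phase, norm_phase, mul_one, one_mul]

/-- Euler's formula, with (2l+1)π/(2α) = 2πν for ν = (2l+1)/(4α). -/
theorem localSine_eq_localExp_sub (α : ℝ) (b : ℝ → ℂ) (k : ℤ) (l : ℕ) (t : ℝ) :
    localSine α b k l t = localExp α b (α * k, (2 * l + 1) / (4 * α)) t -
      localExp α b (α * k, -((2 * l + 1) / (4 * α))) t := by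
  set ν : ℝ := (2 * l + 1) / (4 * α) with hν
  have h1 : (Real.sin ((2 * l + 1) * π / (2 * α) * (t - α * k)) : ℂ) =
      (phase (-(ν * (t - α * k))) - phase (ν * (t - α * k))) / (2 * Complex.I) := by
    rw [show (2 * l + 1) * π / (2 * α) * (t - α * k) = 2 * π * (ν * (t - α * k)) by
      rw [hν]; ring, Complex.ofReal_sin, Complex.sin, phase, phase]
    have hI : Complex.I ≠ 0 := Complex.I_ne_zero
    rw [div_eq_div_iff two_ne_zero (by simp)]
    have e1 : -2 * (π : ℂ) * Complex.I * ((-(ν * (t - α * k)) : ℝ) : ℂ) =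
        ((2 * π * (ν * (t - α * k)) : ℝ) : ℂ) * Complex.I := by push_cast; ring
    have e2 : -2 * (π : ℂ) * Complex.I * ((ν * (t - α * k) : ℝ) : ℂ) =
        -((2 * π * (ν * (t - α * k)) : ℝ) : ℂ) * Complex.I := by push_cast; ring
    rw [e1, e2]
    linear_combination 2 * (Complex.exp (-((2 * π * (ν * (t - α * k)) : ℝ) : ℂ) * Complex.I) -
      Complex.exp (((2 * π * (ν * (t - α * k)) : ℝ) : ℂ) * Complex.I)) * Complex.I_mul_I
  have h2 : phase (-(ν * (t - α * k))) = phase (ν * (α * k)) * phase (-(ν * t)) := by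
    rw [← phase_add]; congr 1; ring
  have h3 : phase (ν * (t - α * k)) = phase (-ν * (α * k)) * phase (-(-ν * t)) := by
    rw [← phase_add]; congr 1; ring
  rw [localSine, h1, h2, h3]
  simp only [localExp]
  ring

theorem localSineLp_eq (α : ℝ) {b : ℝ → ℂ} (hb : MemLp b 2 volume) (k : ℤ) (l : ℕ) :
    localSineLp α hb k l = (memLp_localExp α hb (α * k, (2 * l + 1) / (4 * α))).toLp _ -
      (memLp_localExp α hb (α * k, -((2 * l + 1) / (4 * α)))).toLp _ := by
  rw [← MemLp.toLp_sub, localSineLp]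
  exact MemLp.toLp_congr _ _
    (Filter.Eventually.of_forall (localSine_eq_localExp_sub α b k l))

/-- Each ψ sits in phase space at the two points (αk, ±ν). Of the four cross terms, those with equal
signs are at frequency distance |ν-ν'|, those with opposite signs at distance ν+ν'; this gives each
weight twice. -/
theorem IsWeylOperator.exists_bound_localSine {α : ℝ} (hα : 0 < α) {N : ℕ} {s : ℝ} (hs : 2 < s)
    (hN : s < N) {σ : 𝓢'(ℝ × ℝ, ℂ)} (h : MemModulation s σ)
    {T : Lp ℂ 2 (volume : Measure ℝ) →L[ℂ] Lp ℂ 2 (volume : Measure ℝ)}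
    (hT : IsWeylOperator σ T) {b : ℝ → ℂ} (hb : MemLp b 2 volume)
    (hbA : MemAmalgam α N (stft b b)) :
    ∃ C : ℝ, ∀ (k k' : ℤ) (l l' : ℕ),
      ‖(inner ℂ (localSineLp α hb k l) (T (localSineLp α hb k' l')) : ℂ)‖ ≤
        C * (weight s (α * ((k : ℝ) - k'), ((l : ℝ) - l') / (2 * α)) +
          weight s (α * ((k : ℝ) - k'), ((l : ℝ) + l') / (2 * α))) := by
  obtain ⟨K, hK0, hK⟩ := hT.exists_bound_inner hs h
  obtain ⟨A, hA0, hA⟩ := hbA.exists_bound_stft hα hs hN hb gaussian1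
  set B := ‖(Real.sqrt (2 / α) / (2 * Complex.I) : ℂ)‖ * A with hB
  have hB0 : 0 ≤ B := mul_nonneg (norm_nonneg _) hA0
  have hbd : ∀ w z, ‖stft gaussian1 ((memLp_localExp α hb w).toLp _) z‖ ≤
      B * weight s (z - w) := fun w z => by
    rw [norm_stft_localExp α hb, hB, mul_assoc]
    gcongr
    exact hA _
  have hpair : ∀ w w' q : ℝ × ℝ, |q.1| ≤ |(w' - w).1| → |q.2| ≤ |(w' - w).2| →
      ‖(inner ℂ ((memLp_localExp α hb w).toLp _)
        (T ((memLp_localExp α hb w').toLp _)) : ℂ)‖ ≤ K * (B * B) * weight s q :=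
    fun w w' q h1 h2 => (hK _ _ B B w' w hB0 hB0 (hbd w') (hbd w)).trans
      (mul_le_mul_of_nonneg_left (weight_mono (by linarith) h1 h2) (by positivity))
  refine ⟨2 * (K * (B * B)), fun k k' l l' => ?_⟩
  rw [localSineLp_eq, localSineLp_eq, map_sub, inner_sub_left, inner_sub_right, inner_sub_right]
  set ν : ℝ := (2 * l + 1) / (4 * α) with hν
  set ν' : ℝ := (2 * l' + 1) / (4 * α) with hν'
  have e1 : |α * ((k : ℝ) - k')| ≤ |α * (k' : ℝ) - α * k| := by
    rw [mul_sub, abs_sub_comm]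
  have e2 : ν - ν' = ((l : ℝ) - l') / (2 * α) := by rw [hν, hν']; field_simp; ring
  -- In fact ν + ν' = (l + l' + 1)/(2α). The extra 1/(2α) only increases the distance, so
  -- monotonicity of the weight absorbs it.
  have e3 : |((l : ℝ) + l') / (2 * α)| ≤ ν + ν' := by
    rw [abs_of_nonneg (by positivity), hν, hν', ← add_div, div_le_div_iff₀ (by positivity)
      (by positivity)]
    nlinarith
  have b1 := hpair (α * k, ν) (α * k', ν') (α * ((k : ℝ) - k'), ((l : ℝ) - l') / (2 * α)) e1
    (by rw [← e2, abs_sub_comm]; rfl)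
  have b2 := hpair (α * k, ν) (α * k', -ν') (α * ((k : ℝ) - k'), ((l : ℝ) + l') / (2 * α)) e1
    (e3.trans ((le_abs_self _).trans_eq (by rw [← abs_neg]; congr 1; simp; ring)))
  have b3 := hpair (α * k, -ν) (α * k', ν') (α * ((k : ℝ) - k'), ((l : ℝ) + l') / (2 * α)) e1
    (e3.trans ((le_abs_self _).trans_eq (by congr 1; simp; ring)))
  have b4 := hpair (α * k, -ν) (α * k', -ν') (α * ((k : ℝ) - k'), ((l : ℝ) - l') / (2 * α)) e1
    (by rw [← e2]; exact le_of_eq (by congr 1; simp; ring))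
  refine (norm_sub_le _ _).trans ((add_le_add (norm_sub_le _ _) (norm_sub_le _ _)).trans ?_)
  linarith

end LocalSine

end

/-! ### The theorem -/

theorem mainTheorem11 (α : ℝ) (hα : 0 < α) (s : ℝ) (N : ℕ) (hs : 2 < s) (hN : s < N) :
    -- Every bell function satisfies the hypothesis of the estimate below
    (∀ b : ℝ → ℝ, LocalSine.IsBellFunction α N b →
      MemLp (fun t => (b t : ℂ)) 2 volume ∧
        LocalSine.MemAmalgam α N
          (LocalSine.stft (fun t => (b t : ℂ)) (fun t => (b t : ℂ)))) ∧
    -- Almost diagonalization of the Weyl operator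
    (∀ σ : 𝓢'(ℝ × ℝ, ℂ), LocalSine.MemModulation s σ →
      ∃ T : Lp ℂ 2 (volume : Measure ℝ) →L[ℂ] Lp ℂ 2 (volume : Measure ℝ),
        LocalSine.IsWeylOperator σ T ∧
        ∀ (b : ℝ → ℂ) (hb : MemLp b 2 volume),
          LocalSine.MemAmalgam α N (LocalSine.stft b b) →
          ∃ C : ℝ, ∀ (k k' : ℤ) (l l' : ℕ),
            ‖(inner ℂ (LocalSine.localSineLp α hb k l)
                (T (LocalSine.localSineLp α hb k' l')) : ℂ)‖ ≤
              C * (LocalSine.japanese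
                    (α * ((k : ℝ) - k'), ((l : ℝ) - l') / (2 * α)) ^ (-s) +
                  LocalSine.japanese
                    (α * ((k : ℝ) - k'), ((l : ℝ) + l') / (2 * α)) ^ (-s))) := by
  refine ⟨fun b hb => hb.memLp_and_memAmalgam hα ?_, fun σ hσ => ?_⟩
  · exact_mod_cast (by linarith : (1 : ℝ) ≤ N)
  obtain ⟨C, hC0, hC⟩ := hσ.exists_bound_wigner hs
  obtain ⟨T, hT⟩ := LocalSine.exists_isWeylOperator hC0 hC
  exact ⟨T, hT, fun b hb hbA => hT.exists_bound_localSine hα hs hN hσ hb hbA⟩
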